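/- Terminology. Let $K=\mathbb R$ or $K=\mathbb C$, and let $V$ be a finite-dimensional $K$-vector space with a triple product $\{x,y,z\}$, $K$-linear in $x$ and $z$ and, in $y$, linear if $K=\mathbb R$ and conjugate linear if $K=\mathbb C$, such that $$\{x,y,z\}=\{z,y,x\},\qquad \{a,b,\{x,y,z\}\}=\{\{a,b,x\},y,z\}-\{x,\{b,a,y\},z\}+\{x,y,\{a,b,z\}\}.$$ Put $L(x,y)z=\{x,y,z\}$. If the trace form $(x,y)\mapsto \operatorname{tr}_K L(x,y)$ is symmetric (for $K=\mathbb C$: Hermitian) and positive definite, then $V$ is called a positive Jordan triple system (PJTS) when $K=\mathbb R$, and a positive Hermitian Jordan triple system (PHJTS) when $K=\mathbb C$. An ideal is a $K$-subspace $W$ with $\{W,V,V\}\subset W$ and $\{V,W,V\}\subset W$; $V$ is simple if $V\neq 0$ and its only ideals are $0$ and $V$. A tripotent is an element $c$ with $\{c,c,c\}=c$; tripotents $c,d$ are orthogonal if $L(c,d)=0$; $c\le d$ means that $d=c+e$ with $e$ a tripotent orthogonal to $c$. A nonzero tripotent is primitive if it is minimal among nonzero tripotents for this order. A Jordan frame is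 a maximal family of mutually orthogonal primitive tripotents. $V$ has rank $r$ if a Jordan frame exists and all Jordan frames have exactly $r$ elements. A complex structure on a PJTS $V$ is a linear map $J$ with $J^2=-\mathrm{id}$ and $J\{x,y,z\}=\{Jx,y,z\}=-\{x,Jy,z\}$. A PJTS $V$ is reduced if $\{x\in V:\{c,c,x\}=x\}=\mathbb R c$ for every primitive tripotent $c$; it is non-reduced if it has no complex structure and is not reduced. The Hermitification of a PJTS $V$ is $\mathbb V=V\otimes_{\mathbb R}\mathbb C$ with the triple product extended to be $\mathbb C$-linear in the outer variables and conjugate linear in the middle one; $z\mapsto\overline z$ denotes the conjugation of $\mathbb V$ with respect to $V$. Proposition. Let $V$ be a simple non-reduced PJTS. Then its Hermitification $\mathbb V$ is a simple PHJTS, $V$ has a (well-defined) rank $r$, and $\mathbb V$ has rank $2r$. Moreover, for every Jordan frame $(c_1,\dots,c_r)$ of $V$ there exist $d_1,\dots,d_r\in\mathbb V$ such that $c_j=d_j+\overline{d_j}$ for all $j$ and $(d_1,\overline{d_1},\dots,d_r,\overline{d_r})$ is a Jordan frame of $\mathbb V$ (in particular $d_1,\dots,d_r$ are mutually orthogonal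 primitive tripotents). -/

import Mathlib

open scoped TensorProduct

namespace JordanTriple

section General

/-! Notions that make sense for a triple product `{x, y, z} = T x y z` over a ring `K`, linear in the
outer variables and `σ`-semilinear in the middle one: `σ = id` over `ℝ`, `σ` = conjugation over
`ℂ`. The operator `L(x, y)` is `T x y`. -/

variable {K V : Type*} [CommRing K] [AddCommGroup V] [Module K V] {σ : K →+* K}

/-- Identities of a Jordan triple system. -/
structure IsJTS (T : V →ₗ[K] V →ₛₗ[σ] V →ₗ[K] V) : Prop where
  symm : ∀ x y z, T x y z = T z y x
  jordan : ∀ a b x y z,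
    T a b (T x y z) = T (T a b x) y z - T x (T b a y) z + T x y (T a b z)

/-- `c` is a tripotent: `{c, c, c} = c`. -/
def IsTripotent (T : V →ₗ[K] V →ₛₗ[σ] V →ₗ[K] V) (c : V) : Prop := T c c c = c

/-- Orthogonality of tripotents: `L(c, d) = 0`. -/
def IsOrthogonal (T : V →ₗ[K] V →ₛₗ[σ] V →ₗ[K] V) (c d : V) : Prop := T c d = 0

/-- The order on tripotents: `c ≤ d` if `d = c + e` with `e` a tripotent orthogonal to `c`. -/
def TripotentLE (T : V →ₗ[K] V →ₛₗ[σ] V →ₗ[K] V) (c d : V) : Prop :=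
  ∃ e, IsTripotent T e ∧ IsOrthogonal T c e ∧ d = c + e

/-- Primitive tripotents: the minimal nonzero tripotents. -/
structure IsPrimitive (T : V →ₗ[K] V →ₛₗ[σ] V →ₗ[K] V) (c : V) : Prop where
  tripotent : IsTripotent T c
  ne_zero : c ≠ 0
  minimal : ∀ d, IsTripotent T d → d ≠ 0 → TripotentLE T d c → d = c

/-- A Jordan frame: a maximal family of mutually orthogonal primitive tripotents. -/
structure IsJordanFrame {ι : Type*} (T : V →ₗ[K] V →ₛₗ[σ] V →ₗ[K] V) (c : ι → V) : Prop where
  primitive : ∀ i, IsPrimitive T (c i)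
  orthogonal : ∀ i j, i ≠ j → IsOrthogonal T (c i) (c j)
  maximal : ∀ e, IsPrimitive T e → ¬ ∀ i, IsOrthogonal T (c i) e

/-- The rank is `r`: there is a Jordan frame with `r` elements, and every Jordan frame has
`r` elements. -/
def HasRank (T : V →ₗ[K] V →ₛₗ[σ] V →ₗ[K] V) (r : ℕ) : Prop :=
  (∃ c : Fin r → V, IsJordanFrame T c) ∧
    ∀ (k : ℕ) (c : Fin k → V), IsJordanFrame T c → k = r

/-- Ideals: subspaces `W` with `{W, V, V} ⊆ W` and `{V, W, V} ⊆ W`. -/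
def IsIdeal (T : V →ₗ[K] V →ₛₗ[σ] V →ₗ[K] V) (W : Submodule K V) : Prop :=
  (∀ w ∈ W, ∀ x y, T w x y ∈ W) ∧ (∀ w ∈ W, ∀ x y, T x w y ∈ W)

/-- Simplicity: `V ≠ 0` and there are no ideals except `0` and `V`. -/
def IsSimple (T : V →ₗ[K] V →ₛₗ[σ] V →ₗ[K] V) : Prop :=
  Nontrivial V ∧ ∀ W : Submodule K V, IsIdeal T W → W = ⊥ ∨ W = ⊤

end General

section Real

variable {V : Type*} [AddCommGroup V] [Module ℝ V]

/-- Positive Jordan triple systems (on a finite-dimensional real vector space): the trace form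
`(x, y) = tr L(x, y)` is symmetric and positive definite. -/
structure IsPJTS (T : V →ₗ[ℝ] V →ₗ[ℝ] V →ₗ[ℝ] V) : Prop extends IsJTS T where
  trace_symm : ∀ x y, LinearMap.trace ℝ V (T x y) = LinearMap.trace ℝ V (T y x)
  trace_pos : ∀ x, x ≠ 0 → 0 < LinearMap.trace ℝ V (T x x)

/-- `J` is a complex structure on the triple system:
`J² = -id` and `J{x, y, z} = {Jx, y, z} = -{x, Jy, z}`. -/
structure IsComplexStructure (T : V →ₗ[ℝ] V →ₗ[ℝ] V →ₗ[ℝ] V) (J : V →ₗ[ℝ] V) : Prop where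
  sq : ∀ x, J (J x) = -x
  left : ∀ x y z, J (T x y z) = T (J x) y z
  middle : ∀ x y z, J (T x y z) = -T x (J y) z

/-- Reduced: `V(c, 1) = ℝ c` for primitive tripotents `c`, where `V(c, 1)` is the eigenspace of
`L(c, c)` for the eigenvalue `1`. -/
def IsReduced (T : V →ₗ[ℝ] V →ₗ[ℝ] V →ₗ[ℝ] V) : Prop :=
  ∀ c, IsPrimitive T c → Module.End.eigenspace (T c c) 1 = Submodule.span ℝ {c}

/-- Non-reduced: without complex structure, and not reduced. -/
def IsNonReduced (T : V →ₗ[ℝ] V →ₗ[ℝ] V →ₗ[ℝ] V) : Prop :=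
  (¬ ∃ J : V →ₗ[ℝ] V, IsComplexStructure T J) ∧ ¬ IsReduced T

end Real

/-- Positive Hermitian Jordan triple systems (on a finite-dimensional complex vector space): the
triple product is conjugate linear in the middle variable and the trace form
`(x, y) = tr_ℂ L(x, y)` is Hermitian and positive definite. -/
structure IsPHJTS {W : Type*} [AddCommGroup W] [Module ℂ W]
    (T : W →ₗ[ℂ] W →ₛₗ[starRingEnd ℂ] W →ₗ[ℂ] W) : Prop extends IsJTS T where
  trace_symm : ∀ x y,
    LinearMap.trace ℂ W (T y x) = starRingEnd ℂ (LinearMap.trace ℂ W (T x y))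
  trace_pos : ∀ x, x ≠ 0 → 0 < (LinearMap.trace ℂ W (T x x)).re

noncomputable section Hermitification

variable {V : Type*} [AddCommGroup V] [Module ℝ V]

/-- The conjugation of the complexification `ℂ ⊗ V` with respect to `V`. -/
def conj (V : Type*) [AddCommGroup V] [Module ℝ V] :
    (ℂ ⊗[ℝ] V) →ₛₗ[starRingEnd ℂ] (ℂ ⊗[ℝ] V) where
  toFun := Complex.conjAe.toLinearMap.rTensor V
  map_add' := map_add _
  map_smul' a z := by
    induction z using TensorProduct.induction_on with
    | zero => simp
    | tmul b x => simp [TensorProduct.smul_tmul']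
    | add z w hz hw => simp only [smul_add, map_add, hz, hw]

theorem conj_tmul (a : ℂ) (x : V) : conj V (a ⊗ₜ[ℝ] x) = (starRingEnd ℂ a) ⊗ₜ[ℝ] x := by
  simp [conj]

/-- For `x ∈ V`, the map `(y, z) ↦ {x, y, z}` extended to `ℂ ⊗ V`, conjugate linearly in `y` and
linearly in `z`. -/
def extendRight (S : V →ₗ[ℝ] V →ₗ[ℝ] V) :
    (ℂ ⊗[ℝ] V) →ₛₗ[starRingEnd ℂ] (ℂ ⊗[ℝ] V) →ₗ[ℂ] (ℂ ⊗[ℝ] V) :=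
  (LinearMap.liftBaseChange ℂ (LinearMap.baseChangeHom ℝ ℂ V V ∘ₗ S)).comp (conj V)

theorem extendRight_tmul (S : V →ₗ[ℝ] V →ₗ[ℝ] V) (b c : ℂ) (y z : V) :
    extendRight S (b ⊗ₜ[ℝ] y) (c ⊗ₜ[ℝ] z) = (starRingEnd ℂ b * c) ⊗ₜ[ℝ] S y z := by
  simp [extendRight, conj_tmul, TensorProduct.smul_tmul']

/-- The triple product of the Hermitification `ℂ ⊗ V` of `V`: the extension of the triple product
of `V` that is complex linear in the outer variables and conjugate linear in the middle one. -/
def hermitification (T : V →ₗ[ℝ] V →ₗ[ℝ] V →ₗ[ℝ] V) :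
    (ℂ ⊗[ℝ] V) →ₗ[ℂ] (ℂ ⊗[ℝ] V) →ₛₗ[starRingEnd ℂ] (ℂ ⊗[ℝ] V) →ₗ[ℂ] (ℂ ⊗[ℝ] V) :=
  LinearMap.liftBaseChange ℂ
    { toFun := fun x => extendRight (T x)
      map_add' := fun x x' => by
        ext y z
        induction y using TensorProduct.induction_on with
        | zero => simp
        | tmul b y => simp [extendRight_tmul, TensorProduct.tmul_add]
        | add y w hy hw =>
          simp_all
          abel
      map_smul' := fun t x => by
        ext y z
        induction y using TensorProduct.induction_on with
        | zero => simp
        | tmul b y => simp [extendRight_tmul]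
        | add y w hy hw => simp_all }

theorem hermitification_tmul (T : V →ₗ[ℝ] V →ₗ[ℝ] V →ₗ[ℝ] V) (a b c : ℂ) (x y z : V) :
    hermitification T (a ⊗ₜ[ℝ] x) (b ⊗ₜ[ℝ] y) (c ⊗ₜ[ℝ] z) =
      (a * starRingEnd ℂ b * c) ⊗ₜ[ℝ] T x y z := by
  simp [hermitification, extendRight_tmul, TensorProduct.smul_tmul', mul_assoc]

end Hermitification

end JordanTriple

/-! Write D(u) = L(u,u), Q(u)x = {u,x,u}, and V_1(c), V_½(c), V_0(c) for the eigenspaces of D(c).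

The Hermitification inherits the axioms because its trace form is the sesquilinear extension of that
of V. An ideal of it meets V, and projects to V, in ideals of V. If these are both trivial in the
same way, the ideal is 0 or everything; otherwise it is the graph of a complex structure on V, which
is excluded.

Let c be a primitive tripotent. Maximizing the quartic form ⟪{x,x,x},x⟫ on unit spheres produces
enough tripotents to show that Q(c) fixes only ℝc. If V_1(c) ≠ ℝc, then V_1(c) contains b with Q(c)b
= -b and {b,c,b} = -c. Put d = (c + ib)/2. Then c = d + d̄, the tripotents d and d̄ are orthogonal,
and the real space fixed by x ↦ {d,x,d} is ℝd, so d is primitive. Doing this for every member of a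
Jordan frame of V gives a Jordan frame of the Hermitification: what is orthogonal to all d_j and
d̄_j is orthogonal to all c_j, hence zero.

Two facts remain. First, frames have a common cardinality, in V and in the Hermitification viewed as
a real triple system: the compact group of isometric automorphisms moves any element into the span
of a given frame (`IsJordanFrame.exists_aut_sum`). Second, V_1(c) ≠ ℝc for every primitive c, not
just for one. A thick and a thin member of a frame have no common V_½
(`IsEuclidean.half_inter_eq_zero`), so a mixed frame would split V into two ideals; and every
primitive tripotent is conjugate, up to sign, to a frame member. -/

namespace JordanTriple

/-! ### Peirce decomposition with respect to one tripotent -/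

section Peirce

variable {V : Type*} [AddCommGroup V] [Module ℝ V] {T : V →ₗ[ℝ] V →ₗ[ℝ] V →ₗ[ℝ] V}

theorem IsJTS.mid (h : IsJTS T) (a b x y z : V) :
    T x (T b a y) z = T (T a b x) y z + T x y (T a b z) - T a b (T x y z) := by
  rw [h.jordan a b x y z]; abel

theorem IsJTS.left (h : IsJTS T) (a b x y z : V) :
    T (T a b x) y z = T a b (T x y z) - T x y (T a b z) + T x (T b a y) z := by
  rw [h.jordan a b x y z]; abel

section Multiple

variable {u : V} {t : ℝ}

/-- Two instances of the Jordan identity are linear equations for D(u)Q(u)x and Q(u)D(u)x; the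
coefficients 2/3 and 1/3 eliminate the former. -/
theorem IsJTS.quad_comp (h : IsJTS T) (hu : T u u u = t • u) (x : V) :
    T u (T u u x) u = t • T u x u := by
  have h1 := h.jordan u u u x u
  have h2 := h.jordan u x u u u
  rw [h.symm x u u, h.symm (T u x u) u u] at h2
  simp only [hu, map_smul, LinearMap.smul_apply] at h1 h2
  linear_combination (norm := module) (2 / 3 : ℝ) • h1 + (1 / 3 : ℝ) • h2

theorem IsJTS.quad_quad (h : IsJTS T) (hu : T u u u = t • u) (x : V) :
    T u (T u x u) u = (2 : ℝ) • T u u (T u u x) - t • T u u x := by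
  have h1 := h.mid x u u u u
  rw [hu, h.symm x u u, h.symm (T u u x) u u, map_smul, h.symm x u u] at h1
  rw [h.symm u x u] at h1
  rw [h1, two_smul]

/-- Comes from evaluating Q(u)²D(u) in two ways. The roots of the polynomial are 0, t/2 and t.
Keeping t arbitrary serves to exclude t ≤ 0 by a trace argument and to treat non-normalized elements
later. -/
theorem IsJTS.cubic (h : IsJTS T) (hu : T u u u = t • u) (x : V) :
    (2 : ℝ) • T u u (T u u (T u u x)) - (3 * t) • T u u (T u u x) + t ^ 2 • T u u x = 0 := by
  have h1 := h.quad_quad hu (T u u x)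
  rw [h.quad_comp hu, map_smul, LinearMap.smul_apply, h.quad_quad hu] at h1
  linear_combination (norm := module) -h1

end Multiple

variable {c : V}

theorem IsJTS.one_smul_tri (hc : IsTripotent T c) : T c c c = (1 : ℝ) • c := by
  rw [one_smul]; exact hc

theorem IsJTS.QD (h : IsJTS T) (hc : IsTripotent T c) (x : V) : T c (T c c x) c = T c x c := by
  simpa using h.quad_comp (IsJTS.one_smul_tri hc) x

theorem IsJTS.QQ (h : IsJTS T) (hc : IsTripotent T c) (x : V) :
    T c (T c x c) c = (2 : ℝ) • T c c (T c c x) - T c c x := by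
  simpa using h.quad_quad (IsJTS.one_smul_tri hc) x

theorem IsJTS.DQ (h : IsJTS T) (hc : IsTripotent T c) (x : V) : T c c (T c x c) = T c x c := by
  rw [h.jordan, h.QD hc, show T c c c = c from hc]; abel

theorem IsJTS.DDD (h : IsJTS T) (hc : IsTripotent T c) (x : V) :
    (2 : ℝ) • T c c (T c c (T c c x)) - (3 : ℝ) • T c c (T c c x) + T c c x = 0 := by
  simpa using h.cubic (IsJTS.one_smul_tri hc) x

/-- The Peirce spaces of other eigenvalues vanish. -/
theorem IsJTS.eq_zero_of_eigen (h : IsJTS T) (hc : IsTripotent T c) {x : V} {m : ℝ}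
    (hx : T c c x = m • x) (hm : m * (2 * m - 1) * (m - 1) ≠ 0) : x = 0 := by
  have h1 := h.DDD hc x
  simp only [hx, map_smul] at h1
  have h2 : (m * (2 * m - 1) * (m - 1)) • x = 0 := by
    linear_combination (norm := module) h1
  exact (smul_eq_zero.mp h2).resolve_left hm

theorem IsJTS.eigen (h : IsJTS T) {p q r : ℝ} {x y z : V} (hx : T c c x = p • x)
    (hy : T c c y = q • y) (hz : T c c z = r • z) :
    T c c (T x y z) = (p - q + r) • T x y z := by
  rw [h.jordan, hx, hy, hz]
  simp only [map_smul, LinearMap.smul_apply]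
  module

/-- The components are the Lagrange interpolation projections 2D² - D, 4(D - D²) and 1 - 3D + 2D²
for the eigenvalues 1, 1/2 and 0. -/
theorem IsJTS.peirce_decomp (h : IsJTS T) (hc : IsTripotent T c) (x : V) :
    ∃ x₁ x₂ x₀, x = x₁ + x₂ + x₀ ∧ T c c x₁ = x₁ ∧ T c c x₂ = (1 / 2 : ℝ) • x₂ ∧ T c c x₀ = 0 := by
  have h1 := h.DDD hc x
  refine ⟨(2 : ℝ) • T c c (T c c x) - T c c x, (4 : ℝ) • (T c c x - T c c (T c c x)),
    x - (3 : ℝ) • T c c x + (2 : ℝ) • T c c (T c c x), by module, ?_, ?_, ?_⟩ <;>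
  simp only [map_sub, map_smul, map_add]
  · linear_combination (norm := module) h1
  · linear_combination (norm := module) (-2 : ℝ) • h1
  · linear_combination (norm := module) h1

theorem IsJTS.quad_eq_zero (h : IsJTS T) (hc : IsTripotent T c) {x : V} {m : ℝ}
    (hx : T c c x = m • x) (hm : m ≠ 1) : T c x c = 0 := by
  have h1 := h.QD hc x
  rw [hx, map_smul, LinearMap.smul_apply] at h1
  have h2 : (m - 1) • T c x c = 0 := by rw [sub_smul, h1, one_smul, sub_self]
  exact (smul_eq_zero.mp h2).resolve_left (sub_ne_zero.mpr hm)

theorem IsJTS.QQ_one (h : IsJTS T) (hc : IsTripotent T c) {x : V} (hx : T c c x = x) :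
    T c (T c x c) c = x := by
  rw [h.QQ hc, hx, hx]; module

/-- A vector of the Peirce space `V(c, 0)` satisfies `L(c, y) = 0`. -/
theorem IsJTS.L_eq_zero (h : IsJTS T) (hc : IsTripotent T c) {y : V} (hy : T c c y = 0) :
    T c y = 0 := by
  have hy' : T c c y = (0 : ℝ) • y := by rw [hy, zero_smul]
  have hc1 := IsJTS.one_smul_tri hc
  ext z
  obtain ⟨z₁, z₂, z₀, rfl, h1, h2, h0⟩ := h.peirce_decomp hc z
  -- The products with z₁ and z₂ would have the impossible eigenvalues 2 and 3/2. The product with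
  -- z₀ lies in V_1(c), where Q(c)² is the identity, but Q(c) kills it.
  have e1 : T c y z₁ = 0 := h.eq_zero_of_eigen hc (h.eigen hc1 hy' (r := 1) (by simpa using h1))
    (by norm_num)
  have e2 : T c y z₂ = 0 := h.eq_zero_of_eigen hc (h.eigen hc1 hy' h2) (by norm_num)
  have h0' : T c c z₀ = (0 : ℝ) • z₀ := by rw [h0, zero_smul]
  have e0 : T c c (T c y z₀) = T c y z₀ := by simpa using h.eigen hc1 hy' h0'
  have e3 : T c y z₀ = 0 := by
    have := h.QQ_one hc e0
    rw [h.mid y c c z₀ c, h.quad_eq_zero hc h0' (by norm_num), h.symm y c c, hy] at this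
    simpa using this.symm
  simp [e1, e2, e3]

theorem IsJTS.L_eq_zero' (h : IsJTS T) (hc : IsTripotent T c) {y : V} (hy : T c c y = 0) :
    T y c = 0 := by
  have h0 := h.L_eq_zero hc hy
  have hy' : T c c y = (0 : ℝ) • y := by rw [hy, zero_smul]
  have hc1 := IsJTS.one_smul_tri hc
  ext z
  obtain ⟨z₁, z₂, z₀, rfl, h1, h2, h3⟩ := h.peirce_decomp hc z
  -- Here the eigenvalue is 0, which does occur, so z₁ is written as Q(c)Q(c)z₁ instead. The other
  -- two components would have eigenvalues -1/2 and -1.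
  have e1 : T y c z₁ = 0 := by
    rw [← h.QQ_one hc h1, h.jordan, h.symm y c c, hy, h0]; simp
  have e2 : T y c z₂ = 0 := by
    have e : T c c (T y c z₂) = (-1 / 2 : ℝ) • T y c z₂ := by
      rw [h.eigen hy' hc1 h2]; norm_num
    exact h.eq_zero_of_eigen hc e (by norm_num)
  have e3 : T y c z₀ = 0 := by
    have h3' : T c c z₀ = (0 : ℝ) • z₀ := by rw [h3, zero_smul]
    exact h.eq_zero_of_eigen hc (h.eigen hy' hc1 h3') (by norm_num)
  simp [e1, e2, e3]

/-- The Peirce spaces `V(c, 1)` and `V(c, 0)` are orthogonal. -/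
theorem IsJTS.L_one_zero (h : IsJTS T) (hc : IsTripotent T c) {x y : V} (hx : T c c x = x)
    (hy : T c c y = 0) : T x y = 0 := by
  ext z
  rw [← h.QQ_one hc hx, h.left, h.L_eq_zero hc hy]
  rw [h.symm _ c y, h.L_eq_zero' hc hy]
  simp

end Peirce

/-! ### Extremal tripotents for an associative inner product -/

section Euclidean

open scoped InnerProductSpace

/-- A Jordan triple system on a Euclidean space whose inner product is associative, such that
`{u, u, u} = t u` with `u ≠ 0` is possible for `t > 0` only. -/
structure IsEuclidean {V : Type*} [NormedAddCommGroup V] [InnerProductSpace ℝ V]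
    (T : V →ₗ[ℝ] V →ₗ[ℝ] V →ₗ[ℝ] V) : Prop extends IsJTS T where
  adj : ∀ x y z w, ⟪T x y z, w⟫_ℝ = ⟪z, T y x w⟫_ℝ
  pos : ∀ (u : V) (t : ℝ), T u u u = t • u → u ≠ 0 → 0 < t

variable {V : Type*} [NormedAddCommGroup V] [InnerProductSpace ℝ V]
  {T : V →ₗ[ℝ] V →ₗ[ℝ] V →ₗ[ℝ] V}

namespace IsEuclidean

theorem adj' (h : IsEuclidean T) (x y z w : V) : ⟪T x y z, w⟫_ℝ = ⟪x, T w z y⟫_ℝ := by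
  rw [h.symm, h.adj, h.symm]

theorem adj_quad (h : IsEuclidean T) (x y z w : V) : ⟪T x y z, w⟫_ℝ = ⟪T x w z, y⟫_ℝ := by
  rw [h.adj, h.symm, ← h.adj, h.symm, real_inner_comm]

/-- L(y,x) is the adjoint of L(x,y). -/
theorem L_swap (h : IsEuclidean T) {x y : V} (hxy : T x y = 0) : T y x = 0 := by
  ext z
  refine ext_inner_right ℝ fun w => ?_
  rw [h.adj, hxy]; simp

theorem L_zero_one (h : IsEuclidean T) {c x y : V} (hc : IsTripotent T c) (hx : T c c x = x)
    (hy : T c c y = 0) : T y x = 0 :=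
  h.L_swap (h.L_one_zero hc hx hy)

theorem orthogonal_iff (h : IsEuclidean T) {c e : V} (hc : IsTripotent T c) :
    IsOrthogonal T c e ↔ T c c e = 0 := by
  refine ⟨fun H => ?_, fun H => h.L_eq_zero hc H⟩
  rw [h.symm, h.L_swap H]; rfl

theorem add_tripotent (h : IsEuclidean T) {c e : V} (hc : IsTripotent T c) (he : IsTripotent T e)
    (hce : IsOrthogonal T c e) : IsTripotent T (c + e) := by
  have h1 : T c e = 0 := hce
  have h2 := h.L_swap h1
  have h3 : T c c e = 0 := (h.orthogonal_iff hc).1 hce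
  have h4 : T e e c = 0 := (h.orthogonal_iff he).1 h2
  unfold IsTripotent at *
  simp [h1, h2, h3, h4, hc, he]

theorem inner_eq_zero (h : IsEuclidean T) {c e : V} (hc : IsTripotent T c)
    (hce : IsOrthogonal T c e) : ⟪c, e⟫_ℝ = 0 := by
  rw [← show T c c c = c from hc, h.adj, (h.orthogonal_iff hc).1 hce, inner_zero_right]

end IsEuclidean

/-- First and second order conditions at the maximum t = 0, obtained by dividing by a power of t and
letting t tend to 0 from the right, for t and for -t. -/
theorem quartic_nonpos {a b c d : ℝ} (hp : ∀ t : ℝ, a * t + b * t ^ 2 + c * t ^ 3 + d * t ^ 4 ≤ 0) :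
    a = 0 ∧ b ≤ 0 := by
  have key : ∀ (p : ℝ → ℝ), Continuous p → (∀ t > 0, p t ≤ 0) → p 0 ≤ 0 := by
    intro p hp h
    have h1 : Filter.Tendsto p (nhdsWithin 0 (Set.Ioi 0)) (nhds (p 0)) :=
      hp.continuousAt.continuousWithinAt
    exact le_of_tendsto h1 (Filter.eventually_of_mem self_mem_nhdsWithin h)
  have h1 := key (fun t => a + b * t + c * t ^ 2 + d * t ^ 3) (by fun_prop) fun t ht => by
    have := hp t; nlinarith
  have h2 := key (fun t => -a + b * t - c * t ^ 2 + d * t ^ 3) (by fun_prop) fun t ht => by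
    have := hp (-t); nlinarith
  have ha : a = 0 := by norm_num at h1 h2; linarith
  subst ha
  have h3 := key (fun t => b + c * t + d * t ^ 2) (by fun_prop) fun t ht => by
    have := hp t
    have ht2 : 0 < t ^ 2 := by positivity
    by_contra hh
    push Not at hh
    nlinarith [mul_pos ht2 hh]
  exact ⟨rfl, by simpa using h3⟩

namespace IsEuclidean

/-- The unit sphere of the subspace is compact. The bound is stated homogeneously so that it can be
expanded along x + t y without normalizing. -/
theorem exists_max [FiniteDimensional ℝ V] (T : V →ₗ[ℝ] V →ₗ[ℝ] V →ₗ[ℝ] V) {U : Submodule ℝ V}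
    (hU : U ≠ ⊥) : ∃ x ∈ U, ‖x‖ = 1 ∧
      ∀ y ∈ U, ⟪T y y y, y⟫_ℝ ≤ ⟪T x x x, x⟫_ℝ * ⟪y, y⟫_ℝ ^ 2 := by
  obtain ⟨v, hv, hv0⟩ := U.ne_bot_iff.1 hU
  have hK : IsCompact ((U : Set V) ∩ Metric.sphere 0 1) :=
    (isCompact_sphere 0 1).inter_left U.closed_of_finiteDimensional
  have hn : ∀ y ∈ U, y ≠ 0 → ‖y‖⁻¹ • y ∈ (U : Set V) ∩ Metric.sphere 0 1 := fun y hy hy0 =>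
    ⟨U.smul_mem _ hy, by simp [norm_smul, hy0]⟩
  have hc : Continuous fun y => ⟪T y y y, y⟫_ℝ := by
    have : Continuous fun y : V => T y y y := by
      let T₂ : V →ₗ[ℝ] V →L[ℝ] V →L[ℝ] V :=
        (((LinearMap.toContinuousLinearMap : _ ≃ₗ[ℝ] (V →L[ℝ] V →L[ℝ] V)).toLinearMap ∘ₗ
          LinearMap.compRight ℝ
            (LinearMap.toContinuousLinearMap : _ ≃ₗ[ℝ] (V →L[ℝ] V)).toLinearMap)) ∘ₗ T
      have h2 : Continuous T₂ := T₂.continuous_of_finiteDimensional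
      exact (h2.clm_apply continuous_id).clm_apply continuous_id
    exact this.inner continuous_id
  obtain ⟨x, ⟨hxU, hx1⟩, hmax⟩ := hK.exists_isMaxOn ⟨_, hn v hv hv0⟩ hc.continuousOn
  refine ⟨x, hxU, by simpa using hx1, fun y hy => ?_⟩
  by_cases hy0 : y = 0
  · simp [hy0]
  have := hmax (hn y hy hy0)
  have hpos : 0 < ‖y‖ := norm_pos_iff.2 hy0
  simp only [map_smul, LinearMap.smul_apply, real_inner_smul_left, real_inner_smul_right,
    Set.mem_ofPred_eq] at this
  rw [real_inner_self_eq_norm_sq]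
  have e : ⟪T y y y, y⟫_ℝ = (‖y‖⁻¹ * (‖y‖⁻¹ * (‖y‖⁻¹ * (‖y‖⁻¹ * ⟪T y y y, y⟫_ℝ)))) * (‖y‖ ^ 2) ^ 2 := by
    field_simp
  rw [e]
  gcongr

theorem quartic_expand (h : IsEuclidean T) (x y : V) (t : ℝ) :
    ⟪T (x + t • y) (x + t • y) (x + t • y), x + t • y⟫_ℝ = ⟪T x x x, x⟫_ℝ +
      4 * ⟪T x x x, y⟫_ℝ * t + (4 * ⟪T x x y, y⟫_ℝ + 2 * ⟪T x y x, y⟫_ℝ) * t ^ 2 +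
      4 * ⟪T y y y, x⟫_ℝ * t ^ 3 + ⟪T y y y, y⟫_ℝ * t ^ 4 := by
  have e1 : ⟪T x x y, x⟫_ℝ = ⟪T x x x, y⟫_ℝ := by rw [h.adj, real_inner_comm]
  have e2 : ⟪T x y x, x⟫_ℝ = ⟪T x x x, y⟫_ℝ := h.adj_quad _ _ _ _
  have e3 : ⟪T y x x, x⟫_ℝ = ⟪T x x x, y⟫_ℝ := by rw [h.symm, e1]
  have e4 : ⟪T y x x, y⟫_ℝ = ⟪T x x y, y⟫_ℝ := by rw [h.symm]
  have e5 : ⟪T y x y, x⟫_ℝ = ⟪T x y x, y⟫_ℝ := by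
    rw [h.adj, real_inner_comm]
  have e6 : ⟪T x y y, x⟫_ℝ = ⟪T x x y, y⟫_ℝ := by
    rw [h.adj, h.symm, real_inner_comm]
  have e7 : ⟪T y y x, x⟫_ℝ = ⟪T x x y, y⟫_ℝ := by rw [h.symm, e6]
  have f1 : ⟪T y y x, y⟫_ℝ = ⟪T y y y, x⟫_ℝ := by rw [h.adj, real_inner_comm]
  have f2 : ⟪T y x y, y⟫_ℝ = ⟪T y y y, x⟫_ℝ := h.adj_quad _ _ _ _
  have f3 : ⟪T x y y, y⟫_ℝ = ⟪T y y y, x⟫_ℝ := by rw [h.symm, f1]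
  simp only [map_add, map_smul, LinearMap.add_apply, LinearMap.smul_apply, inner_add_left,
    inner_add_right, real_inner_smul_left, real_inner_smul_right, e1, e2, e3, e4, e5, e6, e7, f1,
    f2, f3]
  ring

/-- A nonzero subspace that is closed under cubes contains a tripotent of smallest norm, and this
tripotent satisfies a first and a second order condition. -/
theorem exists_tripotent [FiniteDimensional ℝ V] (h : IsEuclidean T) {U : Submodule ℝ V}
    (hU : U ≠ ⊥) (hT : ∀ x ∈ U, T x x x ∈ U) :
    ∃ e ∈ U, IsTripotent T e ∧ e ≠ 0 ∧
      (∀ d ∈ U, IsTripotent T d → d ≠ 0 → ⟪e, e⟫_ℝ ≤ ⟪d, d⟫_ℝ) ∧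
      ∀ y ∈ U, ⟪e, y⟫_ℝ = 0 → 4 * ⟪T e e y, y⟫_ℝ + 2 * ⟪T e y e, y⟫_ℝ ≤ 2 * ⟪y, y⟫_ℝ := by
  obtain ⟨x, hx, hx1, hmax⟩ := exists_max T hU
  have hxx : ⟪x, x⟫_ℝ = 1 := by rw [real_inner_self_eq_norm_sq, hx1, one_pow]
  have hx0 : x ≠ 0 := by rintro rfl; simp at hx1
  set M := ⟪T x x x, x⟫_ℝ with hM
  have key : ∀ y ∈ U, 4 * ⟪T x x x, y⟫_ℝ - 4 * M * ⟪x, y⟫_ℝ = 0 ∧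
      4 * ⟪T x x y, y⟫_ℝ + 2 * ⟪T x y x, y⟫_ℝ - M * (2 * ⟪y, y⟫_ℝ + 4 * ⟪x, y⟫_ℝ ^ 2) ≤ 0 := by
    intro y hy
    refine quartic_nonpos (c := 4 * ⟪T y y y, x⟫_ℝ - M * (4 * ⟪x, y⟫_ℝ * ⟪y, y⟫_ℝ))
      (d := ⟪T y y y, y⟫_ℝ - M * ⟪y, y⟫_ℝ ^ 2) fun t => ?_
    have h1 := hmax (x + t • y) (U.add_mem hx (U.smul_mem _ hy))
    have h2 : ⟪x + t • y, x + t • y⟫_ℝ = 1 + 2 * t * ⟪x, y⟫_ℝ + t ^ 2 * ⟪y, y⟫_ℝ := by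
      simp only [inner_add_left, inner_add_right, real_inner_smul_left, real_inner_smul_right, hxx,
        real_inner_comm x y]
      ring
    rw [h.quartic_expand, h2, ← hM] at h1
    linarith
  -- The first order condition says that {x,x,x} - Mx is orthogonal to U, and this vector itself
  -- lies in U.
  have hcube : T x x x = M • x := by
    have hd : T x x x - M • x ∈ U := U.sub_mem (hT x hx) (U.smul_mem _ hx)
    have h1 := (key _ hd).1
    rw [← sub_eq_zero, ← inner_self_eq_zero (𝕜 := ℝ), inner_sub_left, real_inner_smul_left]
    linarith
  have hMpos := h.pos x M hcube hx0
  have hs : (√M)⁻¹ * ((√M)⁻¹ * ((√M)⁻¹ * M)) = (√M)⁻¹ := by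
    have := Real.mul_self_sqrt hMpos.le
    have h3 : √M ≠ 0 := (Real.sqrt_pos.2 hMpos).ne'
    field_simp
    nlinarith
  have hs2 : (√M)⁻¹ * (√M)⁻¹ = M⁻¹ := by
    rw [← mul_inv, Real.mul_self_sqrt hMpos.le]
  have hs0 : (√M)⁻¹ ≠ 0 := inv_ne_zero (Real.sqrt_pos.2 hMpos).ne'
  -- Rescaling by M^(-1/2) gives a tripotent of squared norm 1/M. The homogeneous bound, applied to
  -- any nonzero tripotent of U, shows that 1/M is the smallest possible value.
  refine ⟨(√M)⁻¹ • x, U.smul_mem _ hx, ?_, smul_ne_zero hs0 hx0, ?_, ?_⟩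
  · simp only [IsTripotent, map_smul, LinearMap.smul_apply, hcube]
    simp only [smul_smul, ← mul_assoc] at hs ⊢
    rw [hs]
  · intro d hd hdt hd0
    have h1 := hmax d hd
    rw [show T d d d = d from hdt] at h1
    have h2 : 0 < ⟪d, d⟫_ℝ := real_inner_self_pos.2 hd0
    rw [real_inner_smul_left, real_inner_smul_right, hxx, mul_one, hs2, inv_le_iff_one_le_mul₀ hMpos]
    have : ⟪d, d⟫_ℝ * 1 ≤ ⟪d, d⟫_ℝ * (⟪d, d⟫_ℝ * M) := by linarith
    exact le_of_mul_le_mul_left this h2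
  · intro y hy hxy
    rw [real_inner_smul_left] at hxy
    have hxy' := (mul_eq_zero.1 hxy).resolve_left hs0
    have h1 := (key y hy).2
    rw [hxy'] at h1
    simp only [map_smul, LinearMap.smul_apply, real_inner_smul_left]
    have e : 4 * ((√M)⁻¹ * ((√M)⁻¹ * ⟪T x x y, y⟫_ℝ)) + 2 * ((√M)⁻¹ * ((√M)⁻¹ * ⟪T x y x, y⟫_ℝ))
        = ((√M)⁻¹ * (√M)⁻¹) * (4 * ⟪T x x y, y⟫_ℝ + 2 * ⟪T x y x, y⟫_ℝ) := by ring
    rw [e, hs2, inv_mul_le_iff₀ hMpos]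
    linarith

end IsEuclidean

end Euclidean

theorem IsJTS.L_quad {V : Type*} [AddCommGroup V] [Module ℝ V] {T : V →ₗ[ℝ] V →ₗ[ℝ] V →ₗ[ℝ] V}
    (h : IsJTS T) {c v : V} (hc : IsTripotent T c) (hv : T c c v = v) :
    T (T c v c) c = T c v := by
  ext z
  have h1 := h.jordan c c c v z
  rw [hv, show T c c c = c from hc] at h1
  rw [h.left, h.symm v c c, hv, h1]
  abel

/-! ### Primitive tripotents and existence of Jordan frames -/

section Euclidean

open scoped InnerProductSpace

/-- The joint Peirce space for the eigenvalue `0` of a family. -/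
def peirceZero {ι V : Type*} [AddCommGroup V] [Module ℝ V] (T : V →ₗ[ℝ] V →ₗ[ℝ] V →ₗ[ℝ] V)
    (c : ι → V) : Submodule ℝ V := ⨅ i, LinearMap.ker (T (c i) (c i))

theorem mem_peirceZero {ι V : Type*} [AddCommGroup V] [Module ℝ V]
    {T : V →ₗ[ℝ] V →ₗ[ℝ] V →ₗ[ℝ] V} {c : ι → V} {x : V} :
    x ∈ peirceZero T c ↔ ∀ i, T (c i) (c i) x = 0 := by
  simp [peirceZero]

variable {V : Type*} [NormedAddCommGroup V] [InnerProductSpace ℝ V]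
  {T : V →ₗ[ℝ] V →ₗ[ℝ] V →ₗ[ℝ] V} {ι : Type*}

namespace IsEuclidean

theorem peirceZero_tri (h : IsEuclidean T) {c : ι → V} {x y z : V} (hx : x ∈ peirceZero T c)
    (hy : y ∈ peirceZero T c) (hz : z ∈ peirceZero T c) : T x y z ∈ peirceZero T c := by
  rw [mem_peirceZero] at *
  intro i
  rw [h.jordan, hx, hy, hz]
  simp

/-- A nonzero tripotent of least norm in the joint 0-space is primitive: a summand d of it lies in
the same joint 0-space, and squared norms of orthogonal tripotents add. -/
theorem exists_primitive [FiniteDimensional ℝ V] (h : IsEuclidean T) {c : ι → V}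
    (hc : ∀ i, IsTripotent T (c i)) (h0 : peirceZero T c ≠ ⊥) :
    ∃ e ∈ peirceZero T c, IsPrimitive T e := by
  obtain ⟨e, heU, he, he0, hmin, -⟩ := h.exists_tripotent h0
    fun x hx => h.peirceZero_tri hx hx hx
  refine ⟨e, heU, he, he0, ?_⟩
  rintro d hd hd0 ⟨f, hf, hdf, rfl⟩
  have h1 : T d d f = 0 := (h.orthogonal_iff hd).1 hdf
  have hdU : d ∈ peirceZero T c := by
    rw [mem_peirceZero] at *
    intro i
    refine (h.orthogonal_iff (hc i)).1 (h.L_eq_zero' (c := c i) (hc i) (heU i) |> fun H => ?_)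
    have h2 : T (d + f) (d + f) (c i) = 0 := by rw [h.symm, h.L_swap H]; rfl
    have h3 : T (d + f) (d + f) d = d := by
      have h4 : T d f = 0 := hdf
      have h5 := h.L_swap h4
      have h6 : T d d d = d := hd
      simp [h4, h5, h6, h.symm f f d]
    exact h.L_zero_one he h3 h2
  have h2 := hmin d hdU hd hd0
  have h3 := h.inner_eq_zero hd hdf
  simp only [inner_add_left, inner_add_right, h3, real_inner_comm d f] at h2
  have h4 : ⟪f, f⟫_ℝ = 0 := le_antisymm (by linarith) real_inner_self_nonneg
  rw [inner_self_eq_zero.1 h4, add_zero]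

/-- Makes the fixed space of Q(c) a subspace to which the extremal construction of tripotents
applies. -/
theorem cube_quad (h : IsEuclidean T) {c x : V} (hc : IsTripotent T c) (hx : T c x c = x) :
    T c (T x x x) c = T x x x := by
  have hD : T c c x = x := by rw [← hx, h.DQ hc]
  have hL : T x c = T c x := by have := h.L_quad hc hD; rwa [hx] at this
  have h1 : T x x c = T x c x := by rw [h.symm, hL]
  have h2 : T x c (T x c x) = T x x x := by
    have h3 := h.mid x c x c x
    rw [hx, add_sub_cancel_right, h.symm _ c x] at h3
    exact h3.symm
  have h4 : T x c c = x := by rw [hL, hx]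
  rw [h.mid x x, h1, h.symm (T x c x), ← hL, h2, h4, add_sub_cancel_right]

/-- If `c` is primitive then the `1`-eigenspace of `x ↦ {c, x, c}` is `ℝ c`. -/
theorem eq_smul_of_primitive [FiniteDimensional ℝ V] (h : IsEuclidean T) {c : V}
    (hc : IsPrimitive T c) {x : V} (hx : T c x c = x) : ∃ t : ℝ, x = t • c := by
  have hct := hc.tripotent
  have hct' : T c c c = c := hct
  by_contra! hne
  let U : Submodule ℝ V := LinearMap.ker ((T c).flip c - LinearMap.id)
  have memU : ∀ y, y ∈ U ↔ T c y c = y := fun y => by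
    simp [U, sub_eq_zero]
  have hcc : 0 < ⟪c, c⟫_ℝ := real_inner_self_pos.2 hc.ne_zero
  set y := x - (⟪c, x⟫_ℝ / ⟪c, c⟫_ℝ) • c with hy
  have hyU : y ∈ U := U.sub_mem ((memU x).2 hx) (U.smul_mem _ ((memU c).2 hct'))
  have hy0 : y ≠ 0 := fun H => hne _ (sub_eq_zero.1 H)
  have hcy : ⟪c, y⟫_ℝ = 0 := by
    rw [hy, inner_sub_right, real_inner_smul_right]
    field_simp
    ring
  -- The extremal tripotent e of the fixed space cannot be ±c: there the second order condition at y
  -- would read 6⟪y,y⟫ ≤ 2⟪y,y⟫.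
  obtain ⟨e, heU, he, he0, -, h2⟩ := h.exists_tripotent (U := U) (fun H => by
    rw [H] at hyU; exact hy0 hyU) fun z hz => (memU _).2 (h.cube_quad hct ((memU z).1 hz))
  have hyQ : T c y c = y := (memU y).1 hyU
  have hyD : T c c y = y := by rw [← hyQ, h.DQ hct]
  have hyy : 0 < ⟪y, y⟫_ℝ := real_inner_self_pos.2 hy0
  have hec : e ≠ c := by
    rintro rfl
    have := h2 y hyU hcy
    rw [hyQ, hyD] at this
    linarith
  have hec' : e ≠ -c := by
    rintro rfl
    have := h2 y hyU (by rw [inner_neg_left, hcy, neg_zero])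
    simp only [map_neg, LinearMap.neg_apply, neg_neg, hyQ, hyD] at this
    linarith
  have heQ : T c e c = e := (memU e).1 heU
  have heD : T c c e = e := by rw [← heQ, h.DQ hct]
  have hL : T e c = T c e := by have := h.L_quad hct heD; rwa [heQ] at this
  have hsq : T e e c = T e c e := by rw [h.symm, hL]
  have he' : T e e e = e := he
  obtain ⟨c₁, c₂, c₀, hdec, d1, d2, d0⟩ := h.peirce_decomp he c
  -- D(e)c equals Q(e)c, which lies in V_1(e); so c has no component in V_½(e), and it splits into
  -- orthogonal tripotents c₁ and c₀. Primitivity then forces c = c₁.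
  have hc₂ : c₂ = 0 := by
    have e1 : T e e (T e e c) = T e e c := by rw [hsq, h.DQ he]
    simp only [hdec, map_add, d1, d2, d0, map_smul, map_zero] at e1
    have e2 : (-1 / 4 : ℝ) • c₂ = 0 := by linear_combination (norm := module) e1
    exact (smul_eq_zero.1 e2).resolve_left (by norm_num)
  subst hc₂
  rw [add_zero] at hdec
  have o1 : T c₁ c₀ = 0 := h.L_one_zero he d1 d0
  have o2 : T c₀ c₁ = 0 := h.L_swap o1
  have hsum : T c₁ c₁ c₁ + T c₀ c₀ c₀ = c₁ + c₀ := by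
    have := hct'
    rw [hdec] at this
    simpa [o1, o2, h.symm c₁ c₁ c₀, h.symm c₀ c₀ c₁] using this
  have t1 : T c₁ c₁ c₁ = c₁ := by
    have d1' : T e e c₁ = (1 : ℝ) • c₁ := by rw [d1, one_smul]
    have d0' : T e e c₀ = (0 : ℝ) • c₀ := by rw [d0, zero_smul]
    have := congrArg (T e e) hsum
    rw [map_add, map_add, h.eigen d1' d1' d1', h.eigen d0' d0' d0', d1, d0] at this
    simpa using this
  have t0 : T c₀ c₀ c₀ = c₀ := by rw [t1] at hsum; exact add_left_cancel hsum
  have hc1 : c₁ ≠ 0 := by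
    rintro rfl
    have e1 : T e e c = 0 := by rw [hdec]; simp [d0]
    have e2 : T c e = 0 := h.L_eq_zero' he e1
    exact he0 (by rw [← heQ, e2]; rfl)
  have hcc1 := hc.minimal c₁ t1 hc1 ⟨c₀, t0, o1, hdec⟩
  rw [hcc1] at d1
  have f1 : T e c e = c := by rw [← hsq, d1]
  have f2 : T e c c = e := by rw [h.symm, heD]
  have f3 : T c e e = c := by rw [h.symm, d1]
  -- Now c = (c + e)/2 + (c - e)/2 with orthogonal tripotent summands, so primitivity of c gives e =
  -- c or e = -c, both already excluded.
  have hp : IsTripotent T ((1 / 2 : ℝ) • (c + e)) := by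
    simp only [IsTripotent, map_smul, map_add, LinearMap.smul_apply, LinearMap.add_apply, hct', heD,
      heQ, he', d1, f1, f2, f3]
    module
  have hq : IsTripotent T ((1 / 2 : ℝ) • (c - e)) := by
    simp only [IsTripotent, map_smul, map_sub, LinearMap.smul_apply, LinearMap.sub_apply, hct', heD,
      heQ, he', d1, f1, f2, f3]
    module
  have hpq : IsOrthogonal T ((1 / 2 : ℝ) • (c + e)) ((1 / 2 : ℝ) • (c - e)) := by
    rw [h.orthogonal_iff hp]
    simp only [map_smul, map_sub, map_add, LinearMap.smul_apply,
      LinearMap.add_apply, hct', heD, heQ, he', d1, f1, f2, f3]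
    module
  by_cases hp0 : (1 / 2 : ℝ) • (c + e) = 0
  · have := (smul_eq_zero.1 hp0).resolve_left (by norm_num)
    exact hec' (eq_neg_of_add_eq_zero_right this)
  · have := hc.minimal _ hp hp0 ⟨_, hq, hpq, by module⟩
    apply hec
    linear_combination (norm := module) (2 : ℝ) • this

theorem linearIndependent (h : IsEuclidean T) {c : ι → V} (hc : ∀ i, IsTripotent T (c i))
    (h0 : ∀ i, c i ≠ 0) (ho : ∀ i j, i ≠ j → IsOrthogonal T (c i) (c j)) :
    LinearIndependent ℝ c :=
  linearIndependent_of_ne_zero_of_inner_eq_zero h0 fun i j hij => h.inner_eq_zero (hc i) (ho i j hij)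

/-- Orthogonal nonzero tripotents are linearly independent, so the dimension bounds the size of an
orthogonal primitive family; one of greatest size is maximal. -/
theorem exists_frame [FiniteDimensional ℝ V] (h : IsEuclidean T) :
    ∃ (k : ℕ) (c : Fin k → V), IsJordanFrame T c := by
  classical
  let P : ℕ → Prop := fun k => ∃ c : Fin k → V, (∀ i, IsPrimitive T (c i)) ∧
    ∀ i j, i ≠ j → IsOrthogonal T (c i) (c j)
  have hP : ∀ k, P k → k ≤ Module.finrank ℝ V := by
    rintro k ⟨c, hc, ho⟩
    simpa using (h.linearIndependent (fun i => (hc i).tripotent) (fun i => (hc i).ne_zero)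
      ho).fintype_card_le_finrank
  have h0 : P 0 := ⟨Fin.elim0, fun i => i.elim0, fun i => i.elim0⟩
  obtain ⟨c, hc, ho⟩ : P (Nat.findGreatest P (Module.finrank ℝ V)) :=
    Nat.findGreatest_spec (Nat.zero_le _) h0
  refine ⟨_, c, hc, ho, fun e he H => ?_⟩
  have h1 : P (Nat.findGreatest P (Module.finrank ℝ V) + 1) := by
    refine ⟨Fin.cons e c, fun i => ?_, fun i j => ?_⟩
    · refine Fin.cases ?_ (fun i => ?_) i
      · simpa using he
      · simpa using hc i
    · refine Fin.cases ?_ (fun i => ?_) i <;> refine Fin.cases ?_ (fun j => ?_) j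
      · simp
      · intro _
        exact h.L_swap (H j)
      · intro _
        simpa using H i
      · intro hij
        simpa using ho i j (fun H => hij (by rw [H]))
  have h2 := Nat.le_findGreatest (hP _ h1) h1
  omega

theorem peirceZero_frame [FiniteDimensional ℝ V] (h : IsEuclidean T) {c : ι → V}
    (hc : IsJordanFrame T c) : peirceZero T c = ⊥ := by
  by_contra H
  obtain ⟨e, he, hp⟩ := h.exists_primitive (fun i => (hc.primitive i).tripotent) H
  exact hc.maximal e hp fun i =>
    (h.orthogonal_iff (hc.primitive i).tripotent).2 (mem_peirceZero.1 he i)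

end IsEuclidean

end Euclidean

/-! ### The compact group of isometric automorphisms -/

section Automorphisms

open scoped InnerProductSpace

variable {V : Type*} [NormedAddCommGroup V] [InnerProductSpace ℝ V] [FiniteDimensional ℝ V]

/-- A trilinear product on a finite-dimensional space as a continuous multilinear map. -/
noncomputable def triCLM (T : V →ₗ[ℝ] V →ₗ[ℝ] V →ₗ[ℝ] V) : V →L[ℝ] V →L[ℝ] V →L[ℝ] V :=
  LinearMap.toContinuousLinearMap
    (((LinearMap.toContinuousLinearMap : _ ≃ₗ[ℝ] (V →L[ℝ] V →L[ℝ] V)).toLinearMap ∘ₗ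
      LinearMap.compRight ℝ
        (LinearMap.toContinuousLinearMap : _ ≃ₗ[ℝ] (V →L[ℝ] V)).toLinearMap) ∘ₗ T)

theorem triCLM_apply (T : V →ₗ[ℝ] V →ₗ[ℝ] V →ₗ[ℝ] V) (x y z : V) :
    triCLM T x y z = T x y z := rfl

/-- The isometric automorphisms of a triple product. -/
def isometricAut (T : V →ₗ[ℝ] V →ₗ[ℝ] V →ₗ[ℝ] V) : Set (V →L[ℝ] V) :=
  {k | (∀ a b c, k (T a b c) = T (k a) (k b) (k c)) ∧ ∀ a b, ⟪k a, k b⟫_ℝ = ⟪a, b⟫_ℝ}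

theorem isCompact_isometricAut (T : V →ₗ[ℝ] V →ₗ[ℝ] V →ₗ[ℝ] V) : IsCompact (isometricAut T) := by
  have : ProperSpace (V →L[ℝ] V) := FiniteDimensional.proper ℝ _
  refine Metric.isCompact_of_isClosed_isBounded ?_ ?_
  · have h1 : isometricAut T = (⋂ a, ⋂ b, ⋂ c, {k : V →L[ℝ] V |
        k (T a b c) = triCLM T (k a) (k b) (k c)}) ∩
        ⋂ a, ⋂ b, {k : V →L[ℝ] V | ⟪k a, k b⟫_ℝ = ⟪a, b⟫_ℝ} := by
      ext k
      simp [isometricAut, triCLM_apply]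
    rw [h1]
    refine IsClosed.inter (isClosed_iInter fun a => isClosed_iInter fun b => isClosed_iInter fun c =>
      isClosed_eq (by fun_prop) (by fun_prop)) (isClosed_iInter fun a => isClosed_iInter fun b =>
      isClosed_eq (by fun_prop) (by fun_prop))
  · rw [isBounded_iff_forall_norm_le]
    refine ⟨1, fun k hk => k.opNorm_le_bound zero_le_one fun x => ?_⟩
    have := hk.2 x x
    rw [real_inner_self_eq_norm_sq, real_inner_self_eq_norm_sq] at this
    rw [one_mul]
    exact le_of_eq ((sq_eq_sq₀ (norm_nonneg _) (norm_nonneg _)).1 this)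

theorem exists_flow (D : V →L[ℝ] V) : ∃ E : ℝ → V →L[ℝ] V, E 0 = 1 ∧ (∀ t, E t * E (-t) = 1) ∧
    (∀ a t, HasDerivAt (fun t => E t a) (D (E t a)) t) ∧
    ∀ t, HasDerivAt (fun t => E (-t)) (-(E (-t) * D)) t := by
  let : NormedAlgebra ℚ (V →L[ℝ] V) := NormedAlgebra.restrictScalars ℚ ℝ _
  refine ⟨fun t => NormedSpace.exp (t • D), by simp, fun t => ?_, fun a t => ?_, fun t => ?_⟩
  · simp only
    rw [← NormedSpace.exp_add_of_commute]
    · simp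
    · exact ((Commute.refl D).smul_left t).smul_right (-t)
  · simpa using (hasDerivAt_exp_smul_const' D t).clm_apply (hasDerivAt_const t a)
  · have := (hasDerivAt_exp_smul_const D (-t)).scomp t (hasDerivAt_neg t)
    rw [neg_one_smul] at this
    exact this

set_option maxSynthPendingDepth 3 in
theorem hasDerivAt_tri (B : V →L[ℝ] V →L[ℝ] V →L[ℝ] V) {f g k : ℝ → V} {f' g' k' : V} {t : ℝ}
    (hf : HasDerivAt f f' t) (hg : HasDerivAt g g' t) (hk : HasDerivAt k k' t) :
    HasDerivAt (fun t => B (f t) (g t) (k t))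
      (B f' (g t) (k t) + B (f t) g' (k t) + B (f t) (g t) k') t := by
  have h1 : HasDerivAt (fun t => B (f t)) (B f') t :=
    B.hasFDerivAt.comp_hasDerivAt t hf
  exact (h1.clm_apply hg).clm_apply hk

/-- Skew derivations integrate to isometric automorphisms. The curve {E(t)a, E(t)b, E(t)c} solves
the linear equation F' = DF, so E(-t)F(t) is constant. -/
theorem flow_mem_isometricAut {T : V →ₗ[ℝ] V →ₗ[ℝ] V →ₗ[ℝ] V} {D : V →L[ℝ] V}
    (hD : ∀ a b c, D (T a b c) = T (D a) b c + T a (D b) c + T a b (D c))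
    (hs : ∀ a b, ⟪D a, b⟫_ℝ + ⟪a, D b⟫_ℝ = 0) {E : ℝ → V →L[ℝ] V} (hE0 : E 0 = 1)
    (hinv : ∀ t, E t * E (-t) = 1) (hda : ∀ a t, HasDerivAt (fun t => E t a) (D (E t a)) t)
    (hneg : ∀ t, HasDerivAt (fun t => E (-t)) (-(E (-t) * D)) t) (t : ℝ) :
    E t ∈ isometricAut T := by
  refine ⟨fun a b c => ?_, fun a b => ?_⟩
  · have hF : ∀ t, HasDerivAt (fun t => triCLM T (E t a) (E t b) (E t c))
        (D (triCLM T (E t a) (E t b) (E t c))) t := fun t => by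
      have h1 := hasDerivAt_tri (triCLM T) (hda a t) (hda b t) (hda c t)
      simp only [triCLM_apply] at h1 ⊢
      rw [hD]
      exact h1
    have hG : ∀ t, HasDerivAt (fun t => E (-t) (triCLM T (E t a) (E t b) (E t c))) 0 t := fun t => by
      have h1 := (hneg t).clm_apply (hF t)
      simpa using h1
    have hconst := is_const_of_deriv_eq_zero (fun t => (hG t).differentiableAt)
      (fun t => (hG t).deriv) t 0
    simp only [neg_zero, hE0, one_apply_eq_self, triCLM_apply] at hconst
    rw [← hconst, ← mul_apply_eq_comp, hinv, one_apply_eq_self]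
  · have hG : ∀ t, HasDerivAt (fun t => ⟪E t a, E t b⟫_ℝ) 0 t := fun t => by
      have h1 := (hda a t).inner ℝ (hda b t)
      rwa [add_comm, hs] at h1
    have hconst := is_const_of_deriv_eq_zero (fun t => (hG t).differentiableAt)
      (fun t => (hG t).deriv) t 0
    simpa [hE0] using hconst

variable {T : V →ₗ[ℝ] V →ₗ[ℝ] V →ₗ[ℝ] V}

/-- Every orbit of the automorphism group meets the elements `y` with `L(x, y) = L(y, x)`. -/
theorem IsEuclidean.exists_aut_comm (h : IsEuclidean T) (x y : V) :
    ∃ k : V ≃ₗ[ℝ] V, (∀ a b c, k (T a b c) = T (k a) (k b) (k c)) ∧ T x (k y) = T (k y) x := by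
  have hne : (isometricAut T).Nonempty := ⟨1, by simp [isometricAut]⟩
  -- The automorphism sought maximizes ⟪x, ky⟫ over the compact group.
  obtain ⟨k, hk, hmax⟩ := (isCompact_isometricAut T).exists_isMaxOn hne
    (f := fun k => ⟪x, k y⟫_ℝ) (by fun_prop)
  have hinj : Function.Injective k := by
    rw [injective_iff_map_eq_zero]
    intro a ha
    have := hk.2 a a
    rw [ha, inner_zero_left] at this
    exact inner_self_eq_zero.1 this.symm
  refine ⟨LinearEquiv.ofInjectiveEndo (k : V →ₗ[ℝ] V) hinj, hk.1, ?_⟩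
  change T x (k y) = T (k y) x
  set w := k y
  -- The operator L(u,v) - L(v,u) is a skew derivation; the derivative of ⟪x, ·⟫ along its flow
  -- vanishes at the maximum.
  have key : ∀ u v, ⟪x, T u v w⟫_ℝ = ⟪x, T v u w⟫_ℝ := by
    intro u v
    let D : V →L[ℝ] V := LinearMap.toContinuousLinearMap (T u v - T v u)
    have hDa : ∀ a, D a = T u v a - T v u a := fun a => rfl
    obtain ⟨E, hE0, hinv, hda, hneg⟩ := exists_flow D
    have hE := flow_mem_isometricAut (T := T) (D := D) (fun a b c => by
      simp only [hDa, h.jordan u v a, h.jordan v u a, map_sub, LinearMap.sub_apply]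
      abel) (fun a b => by
      simp only [hDa, inner_sub_left, inner_sub_right, h.adj]
      ring) hE0 hinv hda hneg
    have hloc : IsLocalMax (fun t : ℝ => ⟪x, E t w⟫_ℝ) 0 := by
      refine Filter.Eventually.of_forall fun t => ?_
      have hm : E t * k ∈ isometricAut T :=
        ⟨fun a b c => by simp [hk.1, (hE t).1], fun a b => by simp [hk.2, (hE t).2]⟩
      have := hmax hm
      simpa [w, hE0] using this
    have hd : HasDerivAt (fun t : ℝ => ⟪x, E t w⟫_ℝ) ⟪x, D w⟫_ℝ 0 := by
      have h2 := (hasDerivAt_const (0 : ℝ) x).inner ℝ (hda w 0)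
      simpa [hE0] using h2
    have := hloc.hasDerivAt_eq_zero hd
    rw [hDa, inner_sub_right] at this
    linarith
  ext v
  refine ext_inner_right ℝ fun u => ?_
  rw [h.adj' x w v u, key, ← h.adj', real_inner_comm, ← h.adj w x]

end Automorphisms

/-! ### Conjugation into the span of a frame; invariance of the rank -/

section Frames

open scoped InnerProductSpace

variable {V : Type*} [NormedAddCommGroup V] [InnerProductSpace ℝ V] [FiniteDimensional ℝ V]
  {T : V →ₗ[ℝ] V →ₗ[ℝ] V →ₗ[ℝ] V} {ι : Type*} [Fintype ι] {c : ι → V}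

namespace IsJordanFrame

theorem tri_ne (hc : IsJordanFrame T c) (h : IsEuclidean T) {i j : ι} (hij : i ≠ j) :
    T (c i) (c i) (c j) = 0 :=
  (h.orthogonal_iff (hc.primitive i).tripotent).1 (hc.orthogonal i j hij)

/-- The relation L(x,y) = L(y,x), for x = ∑ lᵢcᵢ, evaluated at c_k; orthogonality leaves a single
term of L(y,x)c_k. -/
theorem D_eq_sum (hc : IsJordanFrame T c) {l : ι → ℝ} {y : V} (h : IsEuclidean T)
    (hxy : T (∑ i, l i • c i) y = T y (∑ i, l i • c i)) (k : ι) :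
    l k • T (c k) (c k) y = ∑ i, l i • T (c i) y (c k) := by
  have h1 : T (∑ i, l i • c i) y (c k) = ∑ i, l i • T (c i) y (c k) := by
    simp [LinearMap.sum_apply]
  have h2 : T y (∑ i, l i • c i) (c k) = l k • T (c k) (c k) y := by
    simp only [map_sum, map_smul, LinearMap.sum_apply, LinearMap.smul_apply]
    rw [Finset.sum_eq_single k]
    · rw [h.symm]
    · intro i _ hik
      rw [h.symm, show T (c k) (c i) = 0 from hc.orthogonal k i hik.symm]
      simp
    · simp
  rw [← h1, ← h2, hxy]

theorem quad_mixed (hc : IsJordanFrame T c) (h : IsEuclidean T) {i k : ι} (hik : i ≠ k) (y : V) :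
    T (c k) (T (c i) y (c k)) (c k) = 0 := by
  have h1 : T (c k) (c i) = 0 := hc.orthogonal k i hik.symm
  rw [h.symm (c i), h.mid y (c k) (c k) (c i) (c k), h1, h.symm _ (c i) (c k), h1]
  simp

/-- Since every Q(c_k) kills y, only V_½ and V_0 components of y occur. Comparing the relation at
c_j and c_k gives (l_j² - l_k²){c_j,y,c_k} = 0, so distinct positive weights remove all mixed
products, and y falls into the joint 0-space of the frame. -/
theorem eq_zero_of_comm (hc : IsJordanFrame T c) (h : IsEuclidean T) {l : ι → ℝ}
    (hl : ∀ i, 0 < l i) (hinj : Function.Injective l) {y : V}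
    (hxy : T (∑ i, l i • c i) y = T y (∑ i, l i • c i)) (hQ : ∀ k, T (c k) y (c k) = 0) : y = 0 := by
  have hD : ∀ k, T (c k) (c k) (T (c k) (c k) y) = (1 / 2 : ℝ) • T (c k) (c k) y := fun k => by
    have := h.QQ (hc.primitive k).tripotent y
    rw [hQ, map_zero, LinearMap.zero_apply] at this
    linear_combination (norm := module) (-1 / 2 : ℝ) • this
  have hcz : ∀ {j k}, j ≠ k → T (c j) (c j) (c k) = (0 : ℝ) • c k := fun hjk => by
    rw [hc.tri_ne h hjk, zero_smul]
  have hthree : ∀ {i j k}, j ≠ i → j ≠ k → T (c j) (c j) (T (c i) y (c k)) = 0 := by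
    intro i j k hji hjk
    -- This product would have D(c_j)-eigenvalue -1/2.
    have h1 : T (c i) (T (c j) (c j) y) (c k) = 0 := by
      refine h.eq_zero_of_eigen (hc.primitive j).tripotent (h.eigen (hcz hji) (hD j) (hcz hjk)) ?_
      norm_num
    rw [h.jordan, h1, hc.tri_ne h hji, hc.tri_ne h hjk]
    simp
  have htwo : ∀ {j k}, j ≠ k → T (c j) (c j) (T (c j) y (c k)) = (1 / 2 : ℝ) • T (c j) y (c k) := by
    intro j k hjk
    have h1 : T (c j) (y - (2 : ℝ) • T (c j) (c j) y) = 0 := by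
      refine h.L_eq_zero (hc.primitive j).tripotent ?_
      rw [map_sub, map_smul, hD]
      module
    have h2 : T (c j) y (c k) - (2 : ℝ) • T (c j) (T (c j) (c j) y) (c k) = 0 := by
      simpa using congrArg (fun f => f (c k)) h1
    rw [h.jordan, hc.tri_ne h hjk, show T (c j) (c j) (c j) = c j from (hc.primitive j).tripotent,
      map_zero]
    linear_combination (norm := module) (1 / 2 : ℝ) • h2
  -- D(c_j) is applied to the relation at c_k; only the summand i = j survives. The left side is
  -- symmetric in j and k up to the weight because D(c_j) and D(c_k) commute.
  have hmul : ∀ {j k}, j ≠ k → l k • T (c j) (c j) (T (c k) (c k) y) =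
      (l j / 2) • T (c j) y (c k) := by
    intro j k hjk
    rw [← map_smul, hc.D_eq_sum h hxy k, map_sum, Finset.sum_eq_single j]
    · rw [map_smul, htwo hjk]
      module
    · intro i _ hij
      rw [map_smul, hthree hij.symm hjk, smul_zero]
    · simp
  have hN : ∀ {j k}, j ≠ k → T (c j) y (c k) = 0 := by
    intro j k hjk
    have h1 := hmul hjk
    have h2 := hmul hjk.symm
    have h3 : T (c j) (c j) (T (c k) (c k) y) = T (c k) (c k) (T (c j) (c j) y) := by
      rw [h.jordan, hc.tri_ne h hjk]
      simp
    rw [← h3, h.symm (c k) y (c j)] at h2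
    have h4 : ((l j - l k) * (l j + l k)) • T (c j) y (c k) = 0 := by
      linear_combination (norm := module) (2 * l k) • h2 - (2 * l j) • h1
    refine (smul_eq_zero.1 h4).resolve_left (mul_ne_zero ?_ ?_)
    · exact sub_ne_zero.2 (hinj.ne hjk)
    · exact (add_pos (hl j) (hl k)).ne'
  have hmem : y ∈ peirceZero T c := by
    rw [mem_peirceZero]
    intro k
    have h1 := hc.D_eq_sum h hxy k
    rw [Finset.sum_eq_zero fun i _ => ?_] at h1
    · exact (smul_eq_zero.1 h1).resolve_left (hl k).ne'
    · by_cases hik : i = k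
      · rw [hik, hQ, smul_zero]
      · rw [hN hik, smul_zero]
  rw [h.peirceZero_frame hc] at hmem
  simpa using hmem

/-- Applying Q(c_k) to the relation at c_k shows that Q(c_k)y is fixed by Q(c_k), hence a multiple
t_k c_k. Subtracting ∑ t_k c_k reduces to the case where all Q(c_k)y vanish. -/
theorem mem_span_of_comm (hc : IsJordanFrame T c) (h : IsEuclidean T) {l : ι → ℝ}
    (hl : ∀ i, 0 < l i) (hinj : Function.Injective l) {y : V}
    (hxy : T (∑ i, l i • c i) y = T y (∑ i, l i • c i)) : ∃ t : ι → ℝ, y = ∑ i, t i • c i := by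
  have hQ : ∀ k, ∃ t : ℝ, T (c k) y (c k) = t • c k := by
    intro k
    refine h.eq_smul_of_primitive (hc.primitive k) ?_
    have h1 := congrArg (fun v => T (c k) v (c k)) (hc.D_eq_sum h hxy k)
    simp only [map_smul, map_sum, LinearMap.smul_apply, LinearMap.sum_apply] at h1
    rw [Finset.sum_eq_single k (fun i _ hik => by rw [hc.quad_mixed h hik, smul_zero]) (by simp),
      h.QD (hc.primitive k).tripotent] at h1
    exact (smul_right_injective V (hl k).ne' h1).symm
  choose t ht using hQ
  have hcomm : ∀ i, T (∑ j, l j • c j) (c i) = T (c i) (∑ j, l j • c j) := by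
    intro i
    simp only [map_smul, map_sum, LinearMap.smul_apply, LinearMap.sum_apply]
    refine Finset.sum_congr rfl fun j _ => ?_
    by_cases hij : i = j
    · rw [hij]
    · rw [show T (c i) (c j) = 0 from hc.orthogonal i j hij,
        show T (c j) (c i) = 0 from hc.orthogonal j i (Ne.symm hij)]
  refine ⟨t, sub_eq_zero.1 (hc.eq_zero_of_comm h hl hinj ?_ fun k => ?_)⟩
  · rw [map_sub, map_sub, LinearMap.sub_apply, hxy]
    congr 1
    clear hxy
    generalize ∑ j, l j • c j = x at hcomm ⊢
    rw [map_sum, map_sum, LinearMap.sum_apply]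
    refine Finset.sum_congr rfl fun i _ => ?_
    rw [map_smul, map_smul, LinearMap.smul_apply, hcomm]
  · rw [map_sub, LinearMap.sub_apply, ht, map_sum, LinearMap.sum_apply, sub_eq_zero,
      Finset.sum_eq_single k]
    · rw [map_smul, LinearMap.smul_apply,
        show T (c k) (c k) (c k) = c k from (hc.primitive k).tripotent]
    · intro i _ hik
      rw [map_smul, LinearMap.smul_apply,
        show T (c k) (c i) = 0 from hc.orthogonal k i hik.symm]
      simp
    · simp

/-- Up to automorphisms, every element lies in the span of a given Jordan frame. -/
theorem exists_aut_sum (hc : IsJordanFrame T c) (h : IsEuclidean T) (y : V) :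
    ∃ k : V ≃ₗ[ℝ] V, (∀ a b c, k (T a b c) = T (k a) (k b) (k c)) ∧
      ∃ t : ι → ℝ, k y = ∑ i, t i • c i := by
  let l : ι → ℝ := fun i => ((Fintype.equivFin ι i : ℕ) : ℝ) + 1
  obtain ⟨k, hk, hcomm⟩ := h.exists_aut_comm (∑ i, l i • c i) y
  refine ⟨k, hk, hc.mem_span_of_comm h (fun i => by positivity) (fun i j hij => ?_) hcomm⟩
  have : (Fintype.equivFin ι i : ℕ) = Fintype.equivFin ι j := by
    have h1 : ((Fintype.equivFin ι i : ℕ) : ℝ) + 1 = ((Fintype.equivFin ι j : ℕ) : ℝ) + 1 := hij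
    exact_mod_cast add_right_cancel h1
  exact (Fintype.equivFin ι).injective (Fin.ext this)

end IsJordanFrame

theorem IsEuclidean.sum_tri (h : IsEuclidean T) {e : ι → V} (he : ∀ i, IsTripotent T (e i))
    (ho : ∀ i j, i ≠ j → IsOrthogonal T (e i) (e j)) (l m n : ι → ℝ) :
    T (∑ i, l i • e i) (∑ i, m i • e i) (∑ i, n i • e i) = ∑ i, (l i * m i * n i) • e i := by
  have h1 : ∀ i, T (e i) (∑ j, m j • e j) = m i • T (e i) (e i) := fun i => by
    rw [map_sum, Finset.sum_eq_single i]
    · rw [map_smul]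
    · intro j _ hj
      rw [map_smul, show T (e i) (e j) = 0 from ho i j hj.symm, smul_zero]
    · simp
  have h2 : ∀ i, T (e i) (e i) (∑ j, n j • e j) = n i • e i := fun i => by
    rw [map_sum, Finset.sum_eq_single i]
    · rw [map_smul, show T (e i) (e i) (e i) = e i from he i]
    · intro j _ hj
      rw [map_smul, (h.orthogonal_iff (he i)).1 (ho i j hj.symm), smul_zero]
    · simp
  simp only [map_sum T, map_smul T, LinearMap.sum_apply, LinearMap.smul_apply, h1, h2, smul_smul,
    mul_assoc]

/-- Invariant subspaces contain the components for distinct eigenvalues. -/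
theorem mem_of_sum_eigen {κ : Type*} {A : V →ₗ[ℝ] V} {U : Submodule ℝ V}
    (hU : ∀ x ∈ U, A x ∈ U) {e : κ → V} {m : κ → ℝ} (hm : Function.Injective m)
    (he : ∀ i, A (e i) = m i • e i) (s : Finset κ) (hs : ∑ i ∈ s, e i ∈ U) : ∀ i ∈ s, e i ∈ U := by
  classical
  induction s using Finset.induction_on generalizing e with
  | empty => simp
  | insert a s ha ih =>
    have h1 : ∑ i ∈ s, (m i - m a) • e i ∈ U := by
      have h2 := U.sub_mem (hU _ hs) (U.smul_mem (m a) hs)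
      rw [map_sum, Finset.smul_sum, ← Finset.sum_sub_distrib, Finset.sum_insert ha] at h2
      simpa [he, sub_smul] using h2
    have h3 := ih (e := fun i => (m i - m a) • e i) (fun i => by
      simp only [map_smul, he]; rw [smul_comm]) h1
    have h4 : ∀ i ∈ s, e i ∈ U := fun i hi => by
      have : m i - m a ≠ 0 := sub_ne_zero.2 (hm.ne (ne_of_mem_of_not_mem hi ha))
      simpa [this] using U.smul_mem (m i - m a)⁻¹ (h3 i hi)
    intro i hi
    rcases Finset.mem_insert.1 hi with rfl | hi
    · rw [Finset.sum_insert ha] at hs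
      simpa using U.sub_mem hs (U.sum_mem h4)
    · exact h4 i hi

/-- An automorphism k moves ∑ lᵢeᵢ, with distinct lᵢ², to an element y of the span of c. This span
is invariant under D(y), whose eigenvectors k(eᵢ) have distinct eigenvalues lᵢ²; hence it contains
all k(eᵢ), and dimensions are compared. -/
theorem IsJordanFrame.card_le (hc : IsJordanFrame T c) (h : IsEuclidean T) {κ : Type*} [Fintype κ]
    {e : κ → V} (he : IsJordanFrame T e) : Fintype.card κ ≤ Fintype.card ι := by
  let l : κ → ℝ := fun i => ((Fintype.equivFin κ i : ℕ) : ℝ) + 1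
  have hl : ∀ i, 0 < l i := fun i => by positivity
  have hlinj : Function.Injective fun i => l i * l i := fun i j hij => by
    have h1 : l i = l j := by
      have := mul_self_inj_of_nonneg (hl i).le (hl j).le
      exact this.1 hij
    have : (Fintype.equivFin κ i : ℕ) = Fintype.equivFin κ j := by
      exact_mod_cast add_right_cancel h1
    exact (Fintype.equivFin κ).injective (Fin.ext this)
  obtain ⟨k, hk, t, ht⟩ := hc.exists_aut_sum h (∑ i, l i • e i)
  have hct := fun i => (hc.primitive i).tripotent
  have het : ∀ i, IsTripotent T (k (e i)) := fun i => by
    have := hk (e i) (e i) (e i)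
    rw [show T (e i) (e i) (e i) = e i from (he.primitive i).tripotent] at this
    exact this.symm
  have heo : ∀ i j, i ≠ j → IsOrthogonal T (k (e i)) (k (e j)) := fun i j hij => by
    rw [h.orthogonal_iff (het i), ← hk, he.tri_ne h hij, map_zero]
  have hky : k (∑ i, l i • e i) = ∑ i, l i • k (e i) := by simp
  set y := ∑ i, l i • k (e i) with hy
  have hmem : ∀ i, k (e i) ∈ Submodule.span ℝ (Set.range c) := by
    have h1 := mem_of_sum_eigen (A := T y y) (U := Submodule.span ℝ (Set.range c))
      (e := fun i => l i • k (e i)) (m := fun i => l i * l i) (fun x hx => ?_) hlinj (fun i => ?_)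
      Finset.univ ?_
    · intro i
      simpa [(hl i).ne'] using Submodule.smul_mem _ (l i)⁻¹ (h1 i (Finset.mem_univ i))
    · obtain ⟨s, rfl⟩ := (Submodule.mem_span_range_iff_exists_fun ℝ).1 hx
      rw [← hky, ht, h.sum_tri hct hc.orthogonal]
      exact Submodule.sum_mem _ fun i _ => Submodule.smul_mem _ _ (Submodule.subset_span ⟨i, rfl⟩)
    · classical
      have h2 : l i • k (e i) = ∑ j, (if j = i then l i else 0) • k (e j) := by simp
      conv_lhs => rw [h2, hy, h.sum_tri het heo]
      rw [Finset.sum_eq_single i (fun j _ hj => by simp [hj]) (by simp)]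
      simp [smul_smul]
    · rw [← hy, ← hky, ht]
      exact Submodule.sum_mem _ fun i _ => Submodule.smul_mem _ _ (Submodule.subset_span ⟨i, rfl⟩)
  have hli := h.linearIndependent het (fun i => by
    simpa using (he.primitive i).ne_zero) heo
  have h1 := Submodule.finrank_mono (Submodule.span_le.2 (Set.range_subset_iff.2 hmem))
  rw [finrank_span_eq_card hli] at h1
  exact h1.trans (finrank_range_le_card c)

/-- All Jordan frames have the same number of elements. -/
theorem IsJordanFrame.hasRank (h : IsEuclidean T) (hc : IsJordanFrame T c) :
    HasRank T (Fintype.card ι) := by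
  refine ⟨⟨c ∘ (Fintype.equivFin ι).symm, fun i => hc.primitive _, fun i j hij =>
    hc.orthogonal _ _ ((Fintype.equivFin ι).symm.injective.ne hij), fun e he H =>
    hc.maximal e he fun i => ?_⟩, fun k e he => ?_⟩
  · simpa using H (Fintype.equivFin ι i)
  · have h1 := hc.card_le h he
    have h2 := he.card_le h hc
    simp only [Fintype.card_fin] at h1 h2
    exact le_antisymm h1 h2

/-- Up to automorphisms and signs, the primitive tripotents are members of a given frame. -/
theorem IsJordanFrame.exists_aut_eq (hc : IsJordanFrame T c) (h : IsEuclidean T) {e : V}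
    (he : IsPrimitive T e) : ∃ k : V ≃ₗ[ℝ] V, (∀ a b c, k (T a b c) = T (k a) (k b) (k c)) ∧
      ∃ i, ∃ t : ℝ, t * t = 1 ∧ k e = t • c i := by
  classical
  obtain ⟨k, hk, t, ht⟩ := hc.exists_aut_sum h e
  have hk' : ∀ a b c, k.symm (T a b c) = T (k.symm a) (k.symm b) (k.symm c) := fun a b c => by
    apply k.injective
    simp [hk]
  have hct := fun i => (hc.primitive i).tripotent
  have hke : T (k e) (k e) (k e) = k e := by
    rw [← hk, show T e e e = e from he.tripotent]
  have hli := h.linearIndependent hct (fun i => (hc.primitive i).ne_zero) hc.orthogonal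
  have hcube : ∀ i, t i * t i * t i = t i := by
    rw [ht, h.sum_tri hct hc.orthogonal] at hke
    have := Fintype.linearIndependent_iff.1 hli (fun i => t i * t i * t i - t i) (by
      simp only [sub_smul, Finset.sum_sub_distrib, hke, sub_self])
    exact fun i => sub_eq_zero.1 (this i)
  obtain ⟨i, hi⟩ : ∃ i, t i ≠ 0 := by
    by_contra! H
    have : k e = 0 := by rw [ht]; simp [H]
    exact he.ne_zero (by simpa using this)
  -- All coefficients satisfy t³ = t, so the i-th term d of k(e) and the remainder f are orthogonal
  -- tripotents; primitivity of e leaves only d.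
  refine ⟨k, hk, i, t i, mul_right_cancel₀ hi (by rw [hcube, one_mul]), ?_⟩
  set f := ∑ j, (if j = i then 0 else t j) • c j with hf
  set d := ∑ j, (if j = i then t j else 0) • c j with hd
  have hd' : d = t i • c i := by simp [hd]
  have hsum : k e = d + f := by
    rw [ht, hd, hf, ← Finset.sum_add_distrib]
    refine Finset.sum_congr rfl fun j _ => ?_
    by_cases hj : j = i <;> simp [hj]
  have hdt : T d d d = d := by
    rw [hd, h.sum_tri hct hc.orthogonal]
    refine Finset.sum_congr rfl fun j _ => ?_
    by_cases hj : j = i <;> simp [hj, hcube]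
  have hft : T f f f = f := by
    rw [hf, h.sum_tri hct hc.orthogonal]
    refine Finset.sum_congr rfl fun j _ => ?_
    by_cases hj : j = i <;> simp [hj, hcube]
  have hdf : T d d f = 0 := by
    rw [hd, hf, h.sum_tri hct hc.orthogonal]
    refine Finset.sum_eq_zero fun j _ => ?_
    by_cases hj : j = i <;> simp [hj]
  have hd0 : d ≠ 0 := by rw [hd']; exact smul_ne_zero hi (hc.primitive i).ne_zero
  have hdt' : IsTripotent T (k.symm d) := by rw [IsTripotent, ← hk', hdt]
  have := he.minimal (k.symm d) hdt' (by simpa using hd0) ⟨k.symm f, by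
    rw [IsTripotent, ← hk', hft], by rw [h.orthogonal_iff hdt', ← hk', hdf, map_zero], by
    rw [← map_add, ← hsum, k.symm_apply_apply]⟩
  rw [← this, k.apply_symm_apply, hd']

end Frames

/-! ### Thin and thick primitive tripotents in a simple system -/

section Simple

open scoped InnerProductSpace

variable {V : Type*} [NormedAddCommGroup V] [InnerProductSpace ℝ V]
  {T : V →ₗ[ℝ] V →ₗ[ℝ] V →ₗ[ℝ] V}

/-- `V(c, 1) = ℝ c`. -/
def IsThin {V : Type*} [AddCommGroup V] [Module ℝ V] (T : V →ₗ[ℝ] V →ₗ[ℝ] V →ₗ[ℝ] V) (c : V) :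
    Prop := ∀ x, T c c x = x → ∃ t : ℝ, x = t • c

/-- {v,v,c} is fixed by Q(c), hence a multiple s c. The vector {v,e,v} lies in V_1(c), and is
recovered by applying Q(c) twice. -/
theorem IsEuclidean.connecting_aux [FiniteDimensional ℝ V] (h : IsEuclidean T) {c e v : V} {m : ℝ}
    (hc : IsPrimitive T c) (hce : T c e = 0) (hcv : T c c v = (1 / 2 : ℝ) • v)
    (hq : T c v e = (m / 2) • v) :
    ∃ s : ℝ, T v v c = s • c ∧ T v e v = (m * s) • c ∧ s * ⟪c, c⟫_ℝ = 1 / 2 * ⟪v, v⟫_ℝ := by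
  have hct := hc.tripotent
  have hc1 := IsJTS.one_smul_tri hct
  have hvc : T v c c = (1 / 2 : ℝ) • v := by rw [h.symm, hcv]
  have hq0 : T c v c = 0 := h.quad_eq_zero hct hcv (by norm_num)
  have hq' : T e v c = (m / 2) • v := by rw [h.symm, hq]
  have hce' : T c c e = (0 : ℝ) • e := by rw [zero_smul]; exact (h.orthogonal_iff hct).1 hce
  have h1 : T c (T v v c) c = T v v c := by
    rw [h.symm v v c, h.mid v c c v c, hvc, hq0]
    simp only [map_smul, LinearMap.smul_apply, map_zero, h.symm v v c]
    module
  obtain ⟨s, hs⟩ := h.eq_smul_of_primitive hc h1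
  refine ⟨s, hs, ?_, ?_⟩
  · have h2 : T c c (T v e v) = T v e v := by
      rw [h.eigen hcv hce' hcv]; norm_num
    have h3 : T c (T v e v) c = (m * s) • c := by
      rw [h.mid e v c v c, hq', hq0]
      simp only [map_smul, LinearMap.smul_apply, map_zero, h.symm c v v, hs]
      module
    have h4 := h.QQ_one hct h2
    rw [h3, map_smul, LinearMap.smul_apply, show T c c c = c from hct] at h4
    exact h4.symm
  · rw [← real_inner_smul_left, ← hs, h.symm, h.adj, hvc, real_inner_smul_right]

/-- The connecting vector v transports thinness. Two computations of {v,v,v} give s = t, so v is a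
multiple of a tripotent. For a skew element b of V_1(c), Q(v)b lies in V_1(e) = ℝe; applying Q(v)
again puts s²b in ℝc, while b is orthogonal to c. -/
theorem IsEuclidean.thin_of_connecting [FiniteDimensional ℝ V] (h : IsEuclidean T) {c e v : V}
    {m : ℝ} (hc : IsPrimitive T c) (he : IsPrimitive T e) (hce : T c e = 0)
    (hcv : T c c v = (1 / 2 : ℝ) • v) (hev : T e e v = (1 / 2 : ℝ) • v) (hv : v ≠ 0)
    (hm : m * m = 1) (hq : T c v e = (m / 2) • v) (hthin : IsThin T e) : IsThin T c := by
  have hct := hc.tripotent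
  have hec := h.L_swap hce
  obtain ⟨s, s1, s2, s3⟩ := h.connecting_aux hc hce hcv hq
  obtain ⟨t, t1, t2, -⟩ := h.connecting_aux he hec hev (by rw [h.symm, hq])
  have hcube1 : T v v v = (2 * t - s) • v := by
    have h1 := h.mid v c v e v
    rw [hq, t2, s2, map_smul, LinearMap.smul_apply] at h1
    simp only [map_smul, LinearMap.smul_apply, hev, h.symm v c c, h.symm v e e, hcv] at h1
    have h2 := congrArg (fun x => (2 * m) • x) h1
    simp only [smul_add, smul_sub, smul_smul] at h2
    rw [show 2 * m * (m / 2) = 1 by linear_combination hm,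
      show 2 * m * (m * t * (1 / 2)) = t by linear_combination t * hm,
      show 2 * m * (m * s * (1 / 2)) = s by linear_combination s * hm] at h2
    rw [one_smul] at h2
    rw [h2]
    module
  have hcube2 : T v v v = (2 * s - t) • v := by
    have h1 := h.mid v e v c v
    rw [h.symm e v c, hq, t2, s2, map_smul, LinearMap.smul_apply] at h1
    simp only [map_smul, LinearMap.smul_apply, hcv, h.symm v c c, h.symm v e e, hev] at h1
    have h2 := congrArg (fun x => (2 * m) • x) h1
    simp only [smul_add, smul_sub, smul_smul] at h2
    rw [show 2 * m * (m / 2) = 1 by linear_combination hm,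
      show 2 * m * (m * t * (1 / 2)) = t by linear_combination t * hm,
      show 2 * m * (m * s * (1 / 2)) = s by linear_combination s * hm] at h2
    rw [one_smul] at h2
    rw [h2]
    module
  have hst : s = t := by
    have : (3 * (t - s)) • v = 0 := by
      linear_combination (norm := module) hcube2 - hcube1
    have := (smul_eq_zero.1 this).resolve_right hv
    linarith
  subst hst
  have hcube : T v v v = s • v := by rw [hcube1]; congr 1; ring
  have hcc : 0 < ⟪c, c⟫_ℝ := real_inner_self_pos.2 hc.ne_zero
  have hvv : 0 < ⟪v, v⟫_ℝ := real_inner_self_pos.2 hv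
  have hs0 : s ≠ 0 := by
    rintro rfl
    linarith
  intro x hx
  set b := x - T c x c with hb
  have hbD : T c c b = b := by rw [hb, map_sub, hx, h.DQ hct]
  have hbQ : T c b c = -b := by
    rw [hb, map_sub, LinearMap.sub_apply, h.QQ_one hct hx, neg_sub]
  suffices hb0 : b = 0 by
    exact h.eq_smul_of_primitive hc (sub_eq_zero.1 hb0).symm
  have hbc : ⟪b, c⟫_ℝ = 0 := by
    have h1 : ⟪T c b c, c⟫_ℝ = ⟪c, b⟫_ℝ := by
      rw [h.adj_quad, show T c c c = c from hct]
    rw [hbQ, inner_neg_left, real_inner_comm] at h1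
    rw [real_inner_comm]
    linarith
  -- D(v)b - s b is fixed by Q(c), hence a multiple of c, and it is orthogonal to c.
  have hDv : T v v b = s • b := by
    have h1 := h.jordan v v c b c
    rw [hbQ, s1] at h1
    simp only [map_neg, map_smul, LinearMap.smul_apply, hbQ] at h1
    have h2 : T c (T v v b - s • b) c = T v v b - s • b := by
      rw [map_sub, LinearMap.sub_apply, map_smul, LinearMap.smul_apply, hbQ]
      linear_combination (norm := module) h1
    obtain ⟨r, hr⟩ := h.eq_smul_of_primitive hc h2
    have h3 : ⟪T v v b - s • b, c⟫_ℝ = 0 := by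
      rw [inner_sub_left, h.adj, s1, real_inner_smul_left, real_inner_smul_right]
      ring
    rw [hr, real_inner_smul_left] at h3
    have hr0 := (mul_eq_zero.1 h3).resolve_right hcc.ne'
    rw [hr0, zero_smul] at hr
    exact sub_eq_zero.1 hr
  have heb : T e e b = (0 : ℝ) • b := by
    rw [zero_smul, h.symm, h.L_one_zero hct hbD ((h.orthogonal_iff hct).1 hce)]
    rfl
  obtain ⟨r, hr⟩ := hthin (T v b v) (by rw [h.eigen hev heb hev]; norm_num)
  have h1 := h.quad_quad hcube b
  rw [hr, hDv, map_smul, LinearMap.smul_apply, s2, map_smul, hDv] at h1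
  have h2 : s ^ 2 * ⟪b, b⟫_ℝ = 0 := by
    rw [← real_inner_smul_right]
    have h3 : s ^ 2 • b = (r * (m * s)) • c := by
      linear_combination (norm := module) -h1
    rw [h3, real_inner_smul_right, hbc, mul_zero]
  exact inner_self_eq_zero.1 ((mul_eq_zero.1 h2).resolve_left (pow_ne_zero 2 hs0))

/-- On the common V_½ of c and e, the operator Q(c + e) = 2{c,·,e} is an involution. Any nonzero v
therefore yields a connecting vector for the sign +1 or -1, and thinness would pass from e to c. -/
theorem IsEuclidean.half_inter_eq_zero [FiniteDimensional ℝ V] (h : IsEuclidean T) {c e v : V}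
    (hc : IsPrimitive T c) (he : IsPrimitive T e) (hce : T c e = 0)
    (hcv : T c c v = (1 / 2 : ℝ) • v) (hev : T e e v = (1 / 2 : ℝ) • v) (hthin : IsThin T e)
    (hthick : ¬ IsThin T c) : v = 0 := by
  have hct := hc.tripotent
  have het := he.tripotent
  have hec := h.L_swap hce
  have hc1 := IsJTS.one_smul_tri hct
  have he1 := IsJTS.one_smul_tri het
  have hce' : T c c e = (0 : ℝ) • e := by rw [zero_smul]; exact (h.orthogonal_iff hct).1 hce
  have hec' : T e e c = (0 : ℝ) • c := by rw [zero_smul]; exact (h.orthogonal_iff het).1 hec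
  have hg := h.add_tripotent hct het hce
  have hQ : ∀ x, T c c x = (1 / 2 : ℝ) • x → T e e x = (1 / 2 : ℝ) • x →
      (2 : ℝ) • T c ((2 : ℝ) • T c x e) e = x := by
    intro x hx hx'
    have hq : ∀ y, T c c y = (1 / 2 : ℝ) • y → T e e y = (1 / 2 : ℝ) • y →
        T (c + e) y (c + e) = (2 : ℝ) • T c y e := by
      intro y hy hy'
      simp only [map_add, LinearMap.add_apply, h.quad_eq_zero hct hy (by norm_num),
        h.quad_eq_zero het hy' (by norm_num), h.symm e y c]
      module
    have hx2 : T c c ((2 : ℝ) • T c x e) = (1 / 2 : ℝ) • (2 : ℝ) • T c x e := by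
      rw [map_smul, h.eigen hc1 hx hce']; module
    have hx3 : T e e ((2 : ℝ) • T c x e) = (1 / 2 : ℝ) • (2 : ℝ) • T c x e := by
      rw [map_smul, h.eigen hec' hx' he1]; module
    rw [← hq _ hx2 hx3, ← hq x hx hx']
    refine h.QQ_one hg ?_
    simp only [map_add, LinearMap.add_apply, hce, hec, hx, hx', LinearMap.zero_apply]
    module
  by_contra hv
  have hq1 := hQ v hcv hev
  set w := (2 : ℝ) • T c v e with hw
  have hwc : T c c w = (1 / 2 : ℝ) • w := by
    rw [hw, map_smul, h.eigen hc1 hcv hce']; module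
  have hwe : T e e w = (1 / 2 : ℝ) • w := by
    rw [hw, map_smul, h.eigen hec' hev he1]; module
  by_cases hwv : w + v = 0
  · refine hthick (h.thin_of_connecting (m := -1) hc he hce hcv hev hv (by norm_num) ?_ hthin)
    have : w = -v := eq_neg_of_add_eq_zero_left hwv
    rw [hw] at this
    linear_combination (norm := module) (1 / 2 : ℝ) • this
  · refine hthick (h.thin_of_connecting (m := 1) (v := w + v) hc he hce ?_ ?_ hwv (by norm_num) ?_
      hthin)
    · rw [map_add, hwc, hcv, smul_add]
    · rw [map_add, hwe, hev, smul_add]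
    · rw [map_add, LinearMap.add_apply]
      have : T c v e = (1 / 2 : ℝ) • w := by rw [hw]; module
      rw [this]
      linear_combination (norm := module) (1 / 2 : ℝ) • hq1

theorem IsJTS.D_comm {V : Type*} [AddCommGroup V] [Module ℝ V] {T : V →ₗ[ℝ] V →ₗ[ℝ] V →ₗ[ℝ] V}
    (h : IsJTS T) {c e : V} (hce : T c c e = 0) (y : V) :
    T c c (T e e y) = T e e (T c c y) := by
  rw [h.jordan, hce]; simp

theorem IsEuclidean.DD_eq_zero (h : IsEuclidean T) {c e : V} (hc : IsTripotent T c)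
    (he : IsTripotent T e) (hce : T c e = 0)
    (H : ∀ v, T c c v = (1 / 2 : ℝ) • v → T e e v = (1 / 2 : ℝ) • v → v = 0) (y : V) :
    T c c (T e e y) = 0 := by
  have hce' : T c c e = 0 := (h.orthogonal_iff hc).1 hce
  have hec' : T e e c = 0 := (h.orthogonal_iff he).1 (h.L_swap hce)
  obtain ⟨y₁, y₂, y₀, rfl, h1, h2, h0⟩ := h.peirce_decomp hc y
  have e1 : T e e y₁ = 0 := by rw [h.symm, h.L_one_zero hc h1 hce']; rfl
  have e0 : T c c (T e e y₀) = 0 := by rw [h.D_comm hce', h0, map_zero]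
  have hd : T c c (T e e y₂) = (1 / 2 : ℝ) • T e e y₂ := by rw [h.D_comm hce', h2, map_smul]
  -- By the cubic identity D(e) - D(e)² maps into V_½(e), and D(e) commutes with D(c); so the
  -- difference lies in the common V_½, which is zero.
  have e2 : T e e y₂ - T e e (T e e y₂) = 0 := by
    refine H _ ?_ ?_
    · rw [map_sub, hd, h.D_comm hce', hd, map_smul, smul_sub]
    · have := h.DDD he y₂
      rw [map_sub]
      linear_combination (norm := module) (-1 / 2 : ℝ) • this
  have e3 : T c c (T e e y₂) = 0 := by
    rw [h.symm c c, h.L_one_zero he (sub_eq_zero.1 e2).symm hec']; rfl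
  simp [e1, e0, e3]

/-- The kernels of D(e) and D(f) together span the space and annihilate each other under L, so ker
D(f) is an ideal containing e but not f. -/
theorem IsEuclidean.not_isSimple (h : IsEuclidean T) {e f : V} (he : IsTripotent T e)
    (hf : IsTripotent T f) (he0 : e ≠ 0) (hf0 : f ≠ 0) (hef : T e f = 0)
    (hD : ∀ y, T e e (T f f y) = 0) (h0 : ∀ y, T e e y = 0 → T f f y = 0 → y = 0) :
    ¬ IsSimple T := by
  have hef' : T e e f = 0 := (h.orthogonal_iff he).1 hef
  have hfe' : T f f e = 0 := (h.orthogonal_iff hf).1 (h.L_swap hef)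
  have hD' : ∀ y, T f f (T e e y) = 0 := fun y => by rw [← h.D_comm hef', hD]
  have one : ∀ {a b x}, T a a b = 0 → IsTripotent T a → T a a x = x → T b b x = 0 := by
    intro a b x hab ha hx
    rw [h.symm, h.L_one_zero ha hx hab]; rfl
  have half : ∀ {a b x}, (∀ y, T b b (T a a y) = 0) → T a a x = (1 / 2 : ℝ) • x → T b b x = 0 := by
    intro a b x hab hx
    have := hab x
    rw [hx, map_smul] at this
    exact (smul_eq_zero.1 this).resolve_left (by norm_num)
  have decomp : ∀ {a b x}, IsTripotent T a → T a a b = 0 → (∀ y, T b b (T a a y) = 0) →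
      (∀ y, T a a y = 0 → T b b y = 0 → y = 0) → T b b x = 0 →
      ∃ x₁ x₂, x = x₁ + x₂ ∧ T a a x₁ = x₁ ∧ T a a x₂ = (1 / 2 : ℝ) • x₂ ∧ T b b x₂ = 0 := by
    intro a b x ha hab hba h00 hx
    obtain ⟨x₁, x₂, x₀, rfl, h1, h2, h3⟩ := h.peirce_decomp ha x
    rw [map_add, map_add, one hab ha h1, half hba h2, zero_add, zero_add] at hx
    rw [h00 x₀ h3 hx]
    exact ⟨x₁, x₂, by simp, h1, h2, half hba h2⟩
  have hL : ∀ w w', T f f w = 0 → T e e w' = 0 → T w w' = 0 := by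
    intro w w' hw hw'
    obtain ⟨w₁, w₂, rfl, p1, p2, p3⟩ := decomp he hef' hD' h0 hw
    rw [map_add, LinearMap.add_apply, h.L_one_zero he p1 hw', zero_add]
    obtain ⟨v₁, v₂, rfl, q1, q2, q3⟩ := decomp hf hfe' hD (fun y a b => h0 y b a) hw'
    rw [map_add, h.L_zero_one hf q1 p3, zero_add]
    ext z
    -- The product has eigenvalue 1/2 for both D(e) and D(f), contrary to D(e)D(f) = 0. As w₂ =
    -- 2{w₂,e,e}, this handles the remaining part of L(w,w').
    have hu : T e w₂ v₂ = 0 := by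
      have u1 : T e e (T e w₂ v₂) = (1 / 2 : ℝ) • T e w₂ v₂ := by
        rw [h.eigen (IsJTS.one_smul_tri he) p2 (r := 0) (by rw [q3, zero_smul])]; norm_num
      have u2 : T f f (T e w₂ v₂) = (1 / 2 : ℝ) • T e w₂ v₂ := by
        rw [h.eigen (p := 0) (q := 0) (by rw [hfe', zero_smul]) (by rw [p3, zero_smul]) q2]
        norm_num
      have u3 := hD (T e w₂ v₂)
      rw [u2, map_smul, u1, smul_smul] at u3
      exact (smul_eq_zero.1 u3).resolve_left (by norm_num)
    have h1 := h.left w₂ e e v₂ z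
    rw [h.symm w₂ e e, p2, hu, h.L_eq_zero he q3] at h1
    simp only [map_smul, LinearMap.smul_apply, LinearMap.zero_apply, map_zero, sub_zero,
      add_zero] at h1
    exact (smul_eq_zero.1 h1).resolve_left (by norm_num)
  have hL' : ∀ w w', T f f w = 0 → T e e w' = 0 → T w' w = 0 := fun w w' hw hw' =>
    h.L_swap (hL w w' hw hw')
  have hsplit : ∀ x, ∃ w w', x = w + w' ∧ T f f w = 0 ∧ T e e w' = 0 := by
    intro x
    obtain ⟨x₁, x₂, x₀, rfl, h1, h2, h3⟩ := h.peirce_decomp he x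
    exact ⟨x₁ + x₂, x₀, rfl, by rw [map_add, one hef' he h1, half hD' h2, add_zero], h3⟩
  have hclosed : ∀ x y z, T f f x = 0 → T f f y = 0 → T f f z = 0 → T f f (T x y z) = 0 := by
    intro x y z hx hy hz
    rw [h.jordan, hx, hy, hz]; simp
  rintro ⟨-, hs⟩
  have hideal : IsIdeal T (LinearMap.ker (T f f)) := by
    constructor <;> intro w hw x y <;> rw [LinearMap.mem_ker] at hw ⊢ <;>
    obtain ⟨x, x', rfl, hx, hx'⟩ := hsplit x <;> obtain ⟨y, y', rfl, hy, hy'⟩ := hsplit y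
    · rw [map_add (T w), hL w x' hw hx', add_zero, map_add (T w x), h.symm w x y', hL' x y' hx hy']
      simpa using hclosed w x y hw hx hy
    · rw [map_add T, LinearMap.add_apply, hL' w x' hw hx', add_zero, map_add (T x w), h.symm x w y',
        hL' w y' hw hy']
      simpa using hclosed x w y hx hw hy
  rcases hs _ hideal with H | H
  · have : e ∈ LinearMap.ker (T f f) := hfe'
    rw [H] at this
    exact he0 (by simpa using this)
  · have : f ∈ LinearMap.ker (T f f) := by rw [H]; trivial
    rw [LinearMap.mem_ker, show T f f f = f from hf] at this
    exact hf0 this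

theorem IsEuclidean.sum_L {ι : Type*} [Fintype ι] {e : ι → V}
    (ho : ∀ i j, i ≠ j → IsOrthogonal T (e i) (e j)) (l m : ι → ℝ) (x : V) :
    T (∑ i, l i • e i) (∑ i, m i • e i) x = ∑ i, (l i * m i) • T (e i) (e i) x := by
  have h1 : ∀ i, T (e i) (∑ j, m j • e j) = m i • T (e i) (e i) := fun i => by
    rw [map_sum, Finset.sum_eq_single i]
    · rw [map_smul]
    · intro j _ hj
      rw [map_smul, show T (e i) (e j) = 0 from ho i j hj.symm, smul_zero]
    · simp
  simp only [map_sum T, map_smul T, LinearMap.sum_apply, LinearMap.smul_apply, h1, smul_smul]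

/-- In a simple system the members of a Jordan frame are all thin or all not thin. -/
theorem IsJordanFrame.thin_of_thin [FiniteDimensional ℝ V] {ι : Type*} [Fintype ι] {c : ι → V}
    (h : IsEuclidean T) (hs : IsSimple T) (hc : IsJordanFrame T c) {i j : ι}
    (hj : IsThin T (c j)) : IsThin T (c i) := by
  classical
  by_contra hi
  -- The frame is cut into the sum of its thick members and the sum of its thin members.
  let l : ι → ℝ := fun i => if IsThin T (c i) then 0 else 1
  let m : ι → ℝ := fun i => if IsThin T (c i) then 1 else 0
  have hll : ∀ i, l i * l i = l i := fun i => by simp [l]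
  have hmm : ∀ i, m i * m i = m i := fun i => by simp [m]
  have hlm : ∀ i, l i * m i = 0 := fun i => by by_cases hi : IsThin T (c i) <;> simp [l, m, hi]
  have hct := fun i => (hc.primitive i).tripotent
  have ho := hc.orthogonal
  have he : IsTripotent T (∑ i, l i • c i) := by
    rw [IsTripotent, h.sum_tri hct ho]; simp only [hll]
  have hf : IsTripotent T (∑ i, m i • c i) := by
    rw [IsTripotent, h.sum_tri hct ho]; simp only [hmm]
  have hli := h.linearIndependent hct (fun i => (hc.primitive i).ne_zero) ho
  have hne : ∀ (n : ι → ℝ) k, n k ≠ 0 → ∑ i, n i • c i ≠ 0 := fun n k hk H =>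
    hk (Fintype.linearIndependent_iff.1 hli n H k)
  refine h.not_isSimple he hf (hne l i (by simp [l, hi])) (hne m j (by simp [m, hj])) ?_ ?_ ?_ hs
  · ext x
    rw [IsEuclidean.sum_L ho]
    simp [hlm]
  · intro y
    rw [IsEuclidean.sum_L ho, IsEuclidean.sum_L ho]
    refine Finset.sum_eq_zero fun a _ => ?_
    rw [map_sum, Finset.smul_sum]
    refine Finset.sum_eq_zero fun b _ => ?_
    by_cases ha : IsThin T (c a)
    · simp [l, ha]
    by_cases hb : IsThin T (c b)
    · have hab : a ≠ b := fun H => ha (H ▸ hb)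
      rw [map_smul, h.DD_eq_zero (hct a) (hct b) (ho a b hab) fun v hv hv' =>
        h.half_inter_eq_zero (hc.primitive a) (hc.primitive b) (ho a b hab) hv hv' hb ha]
      simp
    · simp [m, hb]
  · intro y h1 h2
    have hz : ∀ (n : ι → ℝ), IsTripotent T (∑ i, n i • c i) →
        T (∑ i, n i • c i) (∑ i, n i • c i) y = 0 → ∀ k, n k * n k = 1 → T (c k) (c k) y = 0 := by
      intro n hn hy k hk
      have h3 : T (∑ i, n i • c i) (∑ i, n i • c i) (c k) = c k := by
        rw [IsEuclidean.sum_L ho, Finset.sum_eq_single k]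
        · rw [hk, one_smul]; exact hct k
        · intro b _ hb
          rw [hc.tri_ne h hb, smul_zero]
        · simp
      rw [h.symm, h.L_zero_one hn h3 hy]; rfl
    have hmem : y ∈ peirceZero T c := by
      rw [mem_peirceZero]
      intro k
      by_cases hk : IsThin T (c k)
      · exact hz m hf h2 k (by simp [m, hk])
      · exact hz l he h1 k (by simp [l, hk])
    rw [h.peirceZero_frame hc] at hmem
    simpa using hmem

/-- In a simple system that is not reduced, no primitive tripotent is thin. -/
theorem IsEuclidean.not_isThin [FiniteDimensional ℝ V] (h : IsEuclidean T) (hs : IsSimple T)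
    (hr : ¬ IsReduced T) {c : V} (hc : IsPrimitive T c) : ¬ IsThin T c := by
  intro hthin
  refine hr fun e he => ?_
  obtain ⟨n, f, hf⟩ := h.exists_frame
  -- Automorphisms and signs do not affect thinness, so it can be tested on a frame.
  have key : ∀ {a}, IsPrimitive T a → ∃ i, IsThin T a ↔ IsThin T (f i) := by
    intro a ha
    obtain ⟨k, hk, i, t, ht, hka⟩ := hf.exists_aut_eq h ha
    have hD : ∀ x, k (T a a x) = T (f i) (f i) (k x) := fun x => by
      rw [hk, hka]
      simp [smul_smul, ht]
    refine ⟨i, fun H x hx => ?_, fun H x hx => ?_⟩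
    · obtain ⟨r, hr⟩ := H (k.symm x) (k.injective (by simp [hD, hx]))
      refine ⟨r * t, ?_⟩
      rw [← k.apply_symm_apply x, hr, map_smul, hka, smul_smul]
    · obtain ⟨r, hr⟩ := H (k x) (by rw [← hD, hx])
      refine ⟨r * t, k.injective ?_⟩
      rw [hr, map_smul, hka, smul_smul, mul_assoc, ht, mul_one]
  obtain ⟨i, hi⟩ := key he
  obtain ⟨j, hj⟩ := key hc
  have heT : IsThin T e := hi.2 (hf.thin_of_thin h hs (hj.1 hthin))
  ext x
  rw [Module.End.mem_eigenspace_iff, one_smul, Submodule.mem_span_singleton]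
  refine ⟨fun hx => ?_, ?_⟩
  · obtain ⟨t, ht⟩ := heT x hx
    exact ⟨t, ht.symm⟩
  · rintro ⟨t, rfl⟩
    rw [map_smul, show T e e e = e from he.tripotent]

end Simple

/-! ### From trace forms to Euclidean structures -/

section TraceForm

/-- For t < 0 the operator is t P + (t/2) R with idempotents P and R, whose traces are ranks; for t
= 0 it is nilpotent. For D = L(u,u) with {u,u,u} = t u, this contradicts positivity of the trace
form. -/
theorem trace_re_nonpos {K W : Type*} [RCLike K] [AddCommGroup W] [Module K W]
    [FiniteDimensional K W] (D : W →ₗ[K] W) {t : ℝ} (ht : t ≤ 0)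
    (h : ∀ x, (2 : K) • D (D (D x)) - (3 * t : K) • D (D x) + (t : K) ^ 2 • D x = 0) :
    RCLike.re (LinearMap.trace K W D) ≤ 0 := by
  rcases eq_or_ne t 0 with rfl | ht0
  · have hD : IsNilpotent D := ⟨3, by
      ext x
      have := h x
      simpa [pow_succ] using this⟩
    rw [(LinearMap.isNilpotent_trace_of_isNilpotent hD).eq_zero, map_zero]
  · have hK : (t : K) ≠ 0 := by exact_mod_cast ht0
    have hi : ∀ P : W →ₗ[K] W, IsIdempotentElem P → 0 ≤ RCLike.re (LinearMap.trace K W P) := by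
      intro P hP
      rw [((LinearMap.isProj_range_iff_isIdempotentElem P).2 hP).trace, RCLike.natCast_re]
      positivity
    set s : K := (t : K)⁻¹ with hs
    have h' : ∀ x, D (D (D x)) = (3 / 2 * t : K) • D (D x) - (t ^ 2 / 2 : K) • D x := fun x => by
      linear_combination (norm := module) (1 / 2 : K) • h x
    have hst : s * t = 1 := inv_mul_cancel₀ hK
    have hP := hi ((2 * s ^ 2) • (D * D) - s • D) (by
      ext x
      simp only [Module.End.mul_apply, LinearMap.sub_apply, LinearMap.smul_apply, map_sub, map_smul,
        h']
      match_scalars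
      · rw [hs]; field_simp; ring
      · rw [hs]; field_simp; ring)
    have hR := hi ((4 * s) • D - (4 * s ^ 2) • (D * D)) (by
      ext x
      simp only [Module.End.mul_apply, LinearMap.sub_apply, LinearMap.smul_apply, map_sub, map_smul,
        h']
      match_scalars
      · rw [hs]; field_simp; ring
      · rw [hs]; field_simp; ring)
    have hD : D = (t : K) • ((2 * s ^ 2) • (D * D) - s • D) +
        (t / 2 : K) • ((4 * s) • D - (4 * s ^ 2) • (D * D)) := by
      match_scalars
      · linear_combination -hst
      · ring
    rw [hD, map_add, map_smul, map_smul, smul_eq_mul, smul_eq_mul, map_add]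
    have e : (t / 2 : K) = ((t / 2 : ℝ) : K) := by push_cast; rfl
    rw [e, RCLike.re_ofReal_mul, RCLike.re_ofReal_mul]
    nlinarith

/-- By the Jordan identity the two operators differ by a commutator. -/
theorem IsJTS.trace_assoc {K W : Type*} [CommRing K] [AddCommGroup W] [Module K W] {σ : K →+* K}
    {T : W →ₗ[K] W →ₛₗ[σ] W →ₗ[K] W} (h : IsJTS T) (a b x y : W) :
    LinearMap.trace K W (T (T a b x) y) = LinearMap.trace K W (T x (T b a y)) := by
  have h1 : T (T a b x) y = T a b * T x y - T x y * T a b + T x (T b a y) := by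
    ext z
    simp only [LinearMap.add_apply, LinearMap.sub_apply, Module.End.mul_apply, h.jordan a b x y z]
    abel
  rw [h1, map_add, map_sub, LinearMap.trace_mul_comm, sub_self, zero_add]

/-- A positive definite associative form, together with the positivity of `IsEuclidean`. -/
structure HasForm {V : Type*} [AddCommGroup V] [Module ℝ V] (T : V →ₗ[ℝ] V →ₗ[ℝ] V →ₗ[ℝ] V)
    (B : V → V → ℝ) : Prop extends IsJTS T where
  add : ∀ x y z, B (x + y) z = B x z + B y z
  smul : ∀ (r : ℝ) x y, B (r • x) y = r * B x y
  comm : ∀ x y, B x y = B y x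
  def_pos : ∀ x, x ≠ 0 → 0 < B x x
  adj : ∀ x y z w, B (T x y z) w = B z (T y x w)
  pos : ∀ (u : V) (t : ℝ), T u u u = t • u → u ≠ 0 → 0 < t

/-- The inner product space structure given by a form. -/
@[reducible] def HasForm.core {V : Type*} [AddCommGroup V] [Module ℝ V]
    {T : V →ₗ[ℝ] V →ₗ[ℝ] V →ₗ[ℝ] V} {B : V → V → ℝ} (h : HasForm T B) :
    InnerProductSpace.Core ℝ V where
  inner := B
  conj_inner_symm x y := by simp [h.comm x y]
  re_inner_nonneg x := by
    rcases eq_or_ne x 0 with rfl | hx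
    · have := h.smul 0 0 0
      simp at this
      simp [this]
    · exact (h.def_pos x hx).le
  add_left := h.add
  smul_left x y r := by simp [h.smul]
  definite x hx := by
    by_contra H
    exact (h.def_pos x H).ne' hx

theorem HasForm.hasRank {V : Type*} [AddCommGroup V] [Module ℝ V] [FiniteDimensional ℝ V]
    {T : V →ₗ[ℝ] V →ₗ[ℝ] V →ₗ[ℝ] V} {B : V → V → ℝ} (h : HasForm T B) {ι : Type*} [Fintype ι]
    {c : ι → V} (hc : IsJordanFrame T c) : HasRank T (Fintype.card ι) := by
  let := h.core.toNormedAddCommGroup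
  let := InnerProductSpace.ofCore h.core.toCore
  have hE : IsEuclidean T := { toIsJTS := h.toIsJTS, adj := h.adj, pos := h.pos }
  exact hc.hasRank hE

theorem HasForm.L_swap {V : Type*} [AddCommGroup V] [Module ℝ V]
    {T : V →ₗ[ℝ] V →ₗ[ℝ] V →ₗ[ℝ] V} {B : V → V → ℝ} (h : HasForm T B) {x y : V}
    (hxy : T x y = 0) : T y x = 0 := by
  let := h.core.toNormedAddCommGroup
  let := InnerProductSpace.ofCore h.core.toCore
  have hE : IsEuclidean T := { toIsJTS := h.toIsJTS, adj := h.adj, pos := h.pos }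
  exact hE.L_swap hxy

theorem IsPJTS.hasForm {V : Type*} [AddCommGroup V] [Module ℝ V] [FiniteDimensional ℝ V]
    {T : V →ₗ[ℝ] V →ₗ[ℝ] V →ₗ[ℝ] V} (h : IsPJTS T) :
    HasForm T fun x y => LinearMap.trace ℝ V (T x y) where
  toIsJTS := h.toIsJTS
  add x y z := by simp
  smul r x y := by simp
  comm := h.trace_symm
  def_pos := h.trace_pos
  adj x y z w := h.trace_assoc x y z w
  pos u t hu hu0 := by
    by_contra! ht
    have := trace_re_nonpos (K := ℝ) (T u u) ht fun x => h.cubic hu x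
    exact absurd (h.trace_pos u hu0) (not_lt.2 this)

section Hermitian

variable {W : Type*} [AddCommGroup W] [Module ℂ W] [FiniteDimensional ℂ W]
  {S : W →ₗ[ℂ] W →ₛₗ[starRingEnd ℂ] W →ₗ[ℂ] W}

/-- The underlying real triple product. -/
def realTri (S : W →ₗ[ℂ] W →ₛₗ[starRingEnd ℂ] W →ₗ[ℂ] W) : W →ₗ[ℝ] W →ₗ[ℝ] W →ₗ[ℝ] W :=
  LinearMap.mk₂ ℝ (fun x y => (S x y).restrictScalars ℝ)
    (fun x x' y => by ext; simp) (fun r x y => by ext; simp [← Complex.coe_smul])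
    (fun x y y' => by ext; simp) (fun r x y => by ext; simp [← Complex.coe_smul])

theorem realTri_apply (x y z : W) : realTri S x y z = S x y z := rfl

theorem realTri_eq_zero_iff {x y : W} : realTri S x y = 0 ↔ S x y = 0 := by
  simp only [LinearMap.ext_iff, realTri_apply, LinearMap.zero_apply]

theorem IsPHJTS.hasForm (h : IsPHJTS S) :
    HasForm (realTri S) fun x y => (LinearMap.trace ℂ W (S x y)).re where
  symm := h.symm
  jordan := h.jordan
  add x y z := by simp
  smul r x y := by simp [← Complex.coe_smul]
  comm x y := by rw [h.trace_symm x y]; simp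
  def_pos := h.trace_pos
  adj x y z w := by rw [realTri_apply, realTri_apply, h.trace_assoc]
  pos u t hu hu0 := by
    by_contra! ht
    have h1 : IsJTS (realTri S) := ⟨h.symm, h.jordan⟩
    have := trace_re_nonpos (K := ℂ) (S u u) ht fun x => by
      have h2 := h1.cubic hu x
      simp only [realTri_apply, ← Complex.coe_smul] at h2
      simpa using h2
    exact absurd (h.trace_pos u hu0) (not_lt.2 this)

theorem isPrimitive_realTri {c : W} : IsPrimitive (realTri S) c ↔ IsPrimitive S c := by
  constructor
  · rintro ⟨h1, h2, h3⟩
    refine ⟨h1, h2, fun d hd hd0 ⟨e, he, hde, hc⟩ => h3 d hd hd0 ⟨e, he, ?_, hc⟩⟩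
    exact realTri_eq_zero_iff.2 hde
  · rintro ⟨h1, h2, h3⟩
    refine ⟨h1, h2, fun d hd hd0 ⟨e, he, hde, hc⟩ => h3 d hd hd0 ⟨e, he, ?_, hc⟩⟩
    exact realTri_eq_zero_iff.1 hde

theorem isJordanFrame_realTri {ι : Type*} {c : ι → W} :
    IsJordanFrame (realTri S) c ↔ IsJordanFrame S c := by
  have ho : ∀ x y, IsOrthogonal (realTri S) x y ↔ IsOrthogonal S x y :=
    fun x y => realTri_eq_zero_iff
  constructor
  · rintro ⟨h1, h2, h3⟩
    simp only [ho, isPrimitive_realTri] at h1 h2 h3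
    exact ⟨h1, h2, h3⟩
  · rintro ⟨h1, h2, h3⟩
    simp only [← ho, ← isPrimitive_realTri] at h1 h2 h3
    exact ⟨h1, h2, h3⟩

/-- Tripotents, orthogonality, primitivity and frames are the same for the underlying real triple
product, so invariance of the rank is inherited from the real case. -/
theorem IsPHJTS.hasRank (h : IsPHJTS S) {ι : Type*} [Fintype ι] {c : ι → W}
    (hc : IsJordanFrame S c) : HasRank S (Fintype.card ι) := by
  have : FiniteDimensional ℝ W := FiniteDimensional.complexToReal W
  have h1 := h.hasForm.hasRank (isJordanFrame_realTri.2 hc)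
  simpa only [HasRank, isJordanFrame_realTri] using h1

theorem IsPHJTS.L_swap (h : IsPHJTS S) {x y : W} (hxy : S x y = 0) : S y x = 0 :=
  realTri_eq_zero_iff.1 (h.hasForm.L_swap (realTri_eq_zero_iff.2 hxy))

theorem IsPHJTS.orthogonal_of_apply (h : IsPHJTS S) {c e : W} (hc : IsTripotent S c)
    (hce : S c c e = 0) : IsOrthogonal S c e :=
  realTri_eq_zero_iff.1 (h.hasForm.toIsJTS.L_eq_zero hc hce)

end Hermitian

end TraceForm

/-! ### Positivity and simplicity of the Hermitification -/

section Complexification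

variable {V : Type*} [AddCommGroup V] [Module ℝ V]

/-- The element `x + i y` of the complexification. -/
noncomputable def cx (x y : V) : ℂ ⊗[ℝ] V := (1 : ℂ) ⊗ₜ[ℝ] x + Complex.I ⊗ₜ[ℝ] y

theorem tmul_eq_cx (a : ℂ) (x : V) : a ⊗ₜ[ℝ] x = cx (a.re • x) (a.im • x) := by
  rw [cx, ← TensorProduct.smul_tmul, ← TensorProduct.smul_tmul, ← TensorProduct.add_tmul]
  congr 1
  apply Complex.ext <;> simp

theorem cx_add (x y x' y' : V) : cx x y + cx x' y' = cx (x + x') (y + y') := by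
  simp only [cx, TensorProduct.tmul_add]; abel

theorem exists_cx (z : ℂ ⊗[ℝ] V) : ∃ x y, z = cx x y := by
  induction z using TensorProduct.induction_on with
  | zero => exact ⟨0, 0, by simp [cx]⟩
  | tmul a x => exact ⟨_, _, tmul_eq_cx a x⟩
  | add z w hz hw =>
    obtain ⟨x, y, rfl⟩ := hz
    obtain ⟨x', y', rfl⟩ := hw
    exact ⟨_, _, cx_add _ _ _ _⟩

theorem cx_inj {x y x' y' : V} : cx x y = cx x' y' ↔ x = x' ∧ y = y' := by
  refine ⟨fun h => ⟨?_, ?_⟩, fun ⟨h, h'⟩ => by rw [h, h']⟩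
  · simpa [cx] using congrArg (TensorProduct.lid ℝ V ∘ Complex.reLm.rTensor V) h
  · simpa [cx] using congrArg (TensorProduct.lid ℝ V ∘ Complex.imLm.rTensor V) h

theorem cx_zero : cx (0 : V) 0 = 0 := by simp [cx]

theorem cx_eq_zero {x y : V} : cx x y = 0 ↔ x = 0 ∧ y = 0 := by
  rw [← cx_zero, cx_inj]

theorem real_smul_cx (r : ℝ) (x y : V) : (r : ℂ) • cx x y = cx (r • x) (r • y) := by
  simp only [cx, smul_add, TensorProduct.smul_tmul', ← TensorProduct.smul_tmul, smul_eq_mul]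
  simp

theorem I_smul_cx (x y : V) : Complex.I • cx x y = cx (-y) x := by
  simp only [cx, smul_add, TensorProduct.smul_tmul', smul_eq_mul, Complex.I_mul_I, mul_one,
    TensorProduct.tmul_neg, TensorProduct.neg_tmul]
  abel

theorem conj_cx (x y : V) : conj V (cx x y) = cx x (-y) := by
  simp [cx, conj_tmul, TensorProduct.neg_tmul, TensorProduct.tmul_neg]

theorem hermitification_cx (T : V →ₗ[ℝ] V →ₗ[ℝ] V →ₗ[ℝ] V) (a a' b b' c c' : V) :
    hermitification T (cx a a') (cx b b') (cx c c') =
      cx (T a b c + T a b' c' + T a' b' c - T a' b c')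
        (T a b c' - T a b' c + T a' b c + T a' b' c') := by
  simp only [cx, map_add, LinearMap.add_apply, hermitification_tmul, TensorProduct.tmul_add,
    TensorProduct.tmul_sub, Complex.conj_I, map_one, one_mul, mul_one, mul_neg, neg_mul,
    Complex.I_mul_I, TensorProduct.neg_tmul, neg_neg]
  abel

theorem isJTS_hermitification {T : V →ₗ[ℝ] V →ₗ[ℝ] V →ₗ[ℝ] V} (h : IsJTS T) :
    IsJTS (hermitification T) := by
  constructor
  · intro x y z
    obtain ⟨x, x', rfl⟩ := exists_cx x
    obtain ⟨y, y', rfl⟩ := exists_cx y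
    obtain ⟨z, z', rfl⟩ := exists_cx z
    rw [hermitification_cx, hermitification_cx, cx_inj]
    rw [h.symm z y x, h.symm z y' x', h.symm z' y' x, h.symm z' y x', h.symm z y x', h.symm z y' x,
      h.symm z' y x, h.symm z' y' x']
    constructor <;> abel
  · intro a b x y z
    induction a using TensorProduct.induction_on with
    | zero => simp
    | add p q hp hq => simp only [map_add, LinearMap.add_apply, hp, hq]; abel
    | tmul α a =>
    induction b using TensorProduct.induction_on with
    | zero => simp
    | add p q hp hq => simp only [map_add, LinearMap.add_apply, hp, hq]; abel
    | tmul β b =>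
    induction x using TensorProduct.induction_on with
    | zero => simp
    | add p q hp hq => simp only [map_add, LinearMap.add_apply, hp, hq]; abel
    | tmul ξ x =>
    induction y using TensorProduct.induction_on with
    | zero => simp
    | add p q hp hq => simp only [map_add, LinearMap.add_apply, hp, hq]; abel
    | tmul η y =>
    induction z using TensorProduct.induction_on with
    | zero => simp
    | add p q hp hq => simp only [map_add, hp, hq]; abel
    | tmul ζ z =>
      simp only [hermitification_tmul, h.jordan a b x y z, TensorProduct.tmul_add,
        TensorProduct.tmul_sub, map_mul, Complex.conj_conj]
      have e : ∀ {p q : ℂ} (v : V), p = q → p ⊗ₜ[ℝ] v = q ⊗ₜ[ℝ] v := fun v h => by rw [h]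
      exact congrArg₂ _ (congrArg₂ _ (e _ (by ring)) (e _ (by ring))) (e _ (by ring))

theorem trace_hermitification [FiniteDimensional ℝ V] (T : V →ₗ[ℝ] V →ₗ[ℝ] V →ₗ[ℝ] V) (a b : ℂ)
    (x y : V) : LinearMap.trace ℂ (ℂ ⊗[ℝ] V) (hermitification T (a ⊗ₜ[ℝ] x) (b ⊗ₜ[ℝ] y)) =
      a * starRingEnd ℂ b * (LinearMap.trace ℝ V (T x y) : ℂ) := by
  have h1 : hermitification T (a ⊗ₜ[ℝ] x) (b ⊗ₜ[ℝ] y) =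
      (a * starRingEnd ℂ b) • (T x y).baseChange ℂ := by
    ext z
    simp [hermitification_tmul, TensorProduct.smul_tmul']
  rw [h1, map_smul, LinearMap.trace_baseChange, smul_eq_mul]
  rfl

theorem isPHJTS_hermitification [FiniteDimensional ℝ V] {T : V →ₗ[ℝ] V →ₗ[ℝ] V →ₗ[ℝ] V}
    (h : IsPJTS T) : IsPHJTS (hermitification T) where
  toIsJTS := isJTS_hermitification h.toIsJTS
  trace_symm x y := by
    induction x using TensorProduct.induction_on with
    | zero => simp
    | add p q hp hq => simp only [map_add, LinearMap.add_apply, hp, hq]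
    | tmul a x =>
    induction y using TensorProduct.induction_on with
    | zero => simp
    | add p q hp hq => simp only [map_add, LinearMap.add_apply, hp, hq]
    | tmul b y =>
      rw [trace_hermitification, trace_hermitification, h.trace_symm y x]
      simp only [map_mul, Complex.conj_conj, Complex.conj_ofReal]
      ring
  trace_pos z hz := by
    obtain ⟨x, y, rfl⟩ := exists_cx z
    have hp : ∀ x, 0 ≤ LinearMap.trace ℝ V (T x x) := fun x => by
      rcases eq_or_ne x 0 with rfl | hx
      · simp
      · exact (h.trace_pos x hx).le
    have h1 : (LinearMap.trace ℂ (ℂ ⊗[ℝ] V) (hermitification T (cx x y) (cx x y))).re =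
        LinearMap.trace ℝ V (T x x) + LinearMap.trace ℝ V (T y y) := by
      simp only [cx, map_add, LinearMap.add_apply, trace_hermitification]
      simp [h.trace_symm y x]
    rw [h1]
    by_cases hx : x = 0
    · have hy : y ≠ 0 := fun hy => hz (cx_eq_zero.2 ⟨hx, hy⟩)
      linarith [hp x, h.trace_pos y hy]
    · linarith [hp y, h.trace_pos x hx]

theorem isSimple_hermitification {T : V →ₗ[ℝ] V →ₗ[ℝ] V →ₗ[ℝ] V} (hs : IsSimple T)
    (hJ : ¬ ∃ J : V →ₗ[ℝ] V, IsComplexStructure T J) : IsSimple (hermitification T) := by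
  obtain ⟨hnt, hs⟩ := hs
  refine ⟨?_, fun W hW => ?_⟩
  · obtain ⟨x, hx⟩ := exists_ne (0 : V)
    exact ⟨cx x 0, 0, fun H => hx (cx_eq_zero.1 H).1⟩
  have hI : ∀ {x y}, cx x y ∈ W → cx (-y) x ∈ W := fun {x y} hw => by
    rw [← I_smul_cx]; exact W.smul_mem _ hw
  have hr : ∀ (r : ℝ) {x y}, cx x y ∈ W → cx (r • x) (r • y) ∈ W := fun r x y hw => by
    rw [← real_smul_cx]; exact W.smul_mem _ hw
  have hadd : ∀ {x y x' y'}, cx x y ∈ W → cx x' y' ∈ W → cx (x + x') (y + y') ∈ W :=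
    fun {x y x' y'} hw hw' => by rw [← cx_add]; exact W.add_mem hw hw'
  have hl : ∀ {x y} (a b : V), cx x y ∈ W → cx (T x a b) (T y a b) ∈ W := fun {x y} a b hw => by
    have := hW.1 _ hw (cx a 0) (cx b 0)
    rw [hermitification_cx] at this
    simpa using this
  have hm : ∀ {x y} (a b : V), cx x y ∈ W → cx (T a x b) (-T a y b) ∈ W := fun {x y} a b hw => by
    have := hW.2 _ hw (cx a 0) (cx b 0)
    rw [hermitification_cx] at this
    simpa using this
  -- The intersection of the ideal with V.
  let A : Submodule ℝ V :=
    { carrier := {x | cx x 0 ∈ W}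
      add_mem' := fun {x y} hx hy => by simpa using hadd hx hy
      zero_mem' := by simp [cx_zero]
      smul_mem' := fun r x hx => by simpa using hr r hx }
  have hA : IsIdeal T A :=
    ⟨fun w hw x y => show cx _ 0 ∈ W by simpa using hl x y hw,
      fun w hw x y => show cx _ 0 ∈ W by simpa using hm x y hw⟩
  rcases hs A hA with hA | hA
  swap
  · right
    rw [eq_top_iff]
    intro z _
    obtain ⟨x, y, rfl⟩ := exists_cx z
    have hall : ∀ x, cx x 0 ∈ W := fun x => by
      have : x ∈ A := by rw [hA]; trivial
      exact this
    have h2 : cx 0 y ∈ W := by simpa using hI (hall y)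
    simpa using hadd (hall x) h2
  have hA0 : ∀ x, cx x 0 ∈ W → x = 0 := fun x hx => by
    have : x ∈ A := hx
    rw [hA] at this
    simpa using this
  -- The set of real parts of the ideal.
  let P : Submodule ℝ V :=
    { carrier := {x | ∃ y, cx x y ∈ W}
      add_mem' := fun {x y} ⟨x', hx⟩ ⟨y', hy⟩ => ⟨_, hadd hx hy⟩
      zero_mem' := ⟨0, by simp [cx_zero]⟩
      smul_mem' := fun r x ⟨y, hx⟩ => ⟨_, hr r hx⟩ }
  have hP : IsIdeal T P :=
    ⟨fun w ⟨_, hw⟩ x y => ⟨_, hl x y hw⟩, fun w ⟨_, hw⟩ x y => ⟨_, hm x y hw⟩⟩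
  rcases hs P hP with hP | hP
  · left
    rw [eq_bot_iff]
    intro z hz
    obtain ⟨x, y, rfl⟩ := exists_cx z
    have hP0 : ∀ {x y}, cx x y ∈ W → x = 0 := fun {x y} hw => by
      have : x ∈ P := ⟨y, hw⟩
      rw [hP] at this
      simpa using this
    have h1 := hP0 hz
    have h2 := hP0 (hI hz)
    rw [neg_eq_zero] at h2
    rw [h1, h2, cx_zero]
    exact Submodule.zero_mem _
  -- With A = 0 and P = V, the ideal is the graph of a map J. Closure under multiplication by i
  -- gives J² = -1, and the two ideal conditions give compatibility with the product.
  · exfalso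
    have hex : ∀ x, ∃ y, cx x y ∈ W := fun x => by
      have : x ∈ P := by rw [hP]; trivial
      exact this
    have huniq : ∀ {x y y'}, cx x y ∈ W → cx x y' ∈ W → y = y' := fun {x y y'} h1 h2 => by
      have h3 := hadd (hI h1) (hr (-1) (hI h2))
      have h4 := hA0 (-y + y') (by simpa using h3)
      exact (neg_add_eq_zero.1 h4)
    choose J hJW using hex
    refine hJ ⟨{ toFun := J, map_add' := fun x y => ?_, map_smul' := fun r x => ?_ }, ?_, ?_, ?_⟩
    · exact huniq (hJW _) (hadd (hJW x) (hJW y))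
    · exact huniq (hJW _) (hr r (hJW x))
    · intro x
      have h1 := hr (-1) (hI (hJW x))
      refine huniq (hJW (J x)) (by simpa using h1)
    · intro x y z
      exact huniq (hJW _) (hl y z (hJW x))
    · intro x y z
      exact huniq (hJW _) (hm x z (hJW y))

end Complexification

/-! ### Splitting a primitive tripotent in the Hermitification -/

section Halves

open scoped InnerProductSpace

/-- `b` lies in `V(c, 1)`, is a skew element for `x ↦ {c, x, c}`, and is normalized by
`{b, c, b} = -c`. -/
structure IsSkewUnit {V : Type*} [AddCommGroup V] [Module ℝ V] (T : V →ₗ[ℝ] V →ₗ[ℝ] V →ₗ[ℝ] V)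
    (c b : V) : Prop where
  one : T c c b = b
  skew : T c b c = -b
  norm : T b c b = -c

namespace IsSkewUnit

variable {V : Type*} [AddCommGroup V] [Module ℝ V] {T : V →ₗ[ℝ] V →ₗ[ℝ] V →ₗ[ℝ] V} {c b : V}

theorem neg (hb : IsSkewUnit T c b) : IsSkewUnit T c (-b) :=
  ⟨by simp [hb.one], by simp [hb.skew], by simp [hb.norm]⟩

end IsSkewUnit

section

variable {V : Type*} [AddCommGroup V] [Module ℝ V] {T : V →ₗ[ℝ] V →ₗ[ℝ] V →ₗ[ℝ] V} {c b : V}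

theorem IsJTS.L_skew (h : IsJTS T) (hc : IsTripotent T c) (h1 : T c c b = b)
    (h2 : T c b c = -b) : T c b = -T b c := by
  have := h.L_quad hc h1
  rw [h2, map_neg, LinearMap.neg_apply] at this
  exact this.symm

theorem IsJTS.quad_skew_skew (h : IsJTS T) (hc : IsTripotent T c) (h1 : T c c b = b)
    (h2 : T c b c = -b) {b' : V} (h1' : T c c b' = b') (h2' : T c b' c = -b') :
    T c (T b c b') c = T b c b' := by
  have e1 := h.L_skew hc h1 h2
  have e2 := h.L_skew hc h1' h2'
  have e3 : T b b' c = -T b c b' := by rw [h.symm, e2, LinearMap.neg_apply, h.symm b' c b]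
  rw [h.mid c b c b' c, h2, h2']
  simp only [map_neg, LinearMap.neg_apply, h.symm c b' b, e3, e1]
  abel

/-- Only the V_1(c) component of the middle entry contributes: the others would give the eigenvalues
3/2 and 2. -/
theorem IsJTS.tri_one (h : IsJTS T) (hc : IsTripotent T c) {x y : V} (hx : T c c x = x)
    (hy : T c c y = y) (z : V) : T c c (T x z y) = T x z y := by
  have hx' : T c c x = (1 : ℝ) • x := by rw [hx, one_smul]
  have hy' : T c c y = (1 : ℝ) • y := by rw [hy, one_smul]
  obtain ⟨z₁, z₂, z₀, rfl, h1, h2, h0⟩ := h.peirce_decomp hc z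
  have h1' : T c c z₁ = (1 : ℝ) • z₁ := by rw [h1, one_smul]
  have h0' : T c c z₀ = (0 : ℝ) • z₀ := by rw [h0, zero_smul]
  have e1 := h.eigen hx' h1' hy'
  have e2 : T x z₂ y = 0 := h.eq_zero_of_eigen hc (h.eigen hx' h2 hy') (by norm_num)
  have e0 : T x z₀ y = 0 := h.eq_zero_of_eigen hc (h.eigen hx' h0' hy') (by norm_num)
  simp only [map_add, LinearMap.add_apply, e2, e0, e1]
  simp

end

section Primitive

variable {V : Type*} [NormedAddCommGroup V] [InnerProductSpace ℝ V] [FiniteDimensional ℝ V]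
  {T : V →ₗ[ℝ] V →ₗ[ℝ] V →ₗ[ℝ] V} {c b : V}

/-- If x in V_1(c) is not a multiple of c, then b = x - Q(c)x is skew and nonzero. The vector
{b,c,b} is fixed by Q(c), so it equals r c, where r⟪c,c⟫ = -⟪b,b⟫ < 0; rescaling makes r = -1. -/
theorem IsEuclidean.exists_skewUnit (h : IsEuclidean T) (hc : IsPrimitive T c)
    (hthin : ¬ IsThin T c) : ∃ b, IsSkewUnit T c b := by
  have hct := hc.tripotent
  simp only [IsThin, not_forall] at hthin
  obtain ⟨x, hx, hne⟩ := hthin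
  set b := x - T c x c with hb
  have hb0 : b ≠ 0 := fun H => hne (h.eq_smul_of_primitive hc (sub_eq_zero.1 H).symm)
  have hbD : T c c b = b := by rw [hb, map_sub, hx, h.DQ hct]
  have hbQ : T c b c = -b := by
    rw [hb, map_sub, LinearMap.sub_apply, h.QQ_one hct hx, neg_sub]
  obtain ⟨r, hr⟩ := h.eq_smul_of_primitive hc (h.quad_skew_skew hct hbD hbQ hbD hbQ)
  have hcc : 0 < ⟪c, c⟫_ℝ := real_inner_self_pos.2 hc.ne_zero
  have hbb : 0 < ⟪b, b⟫_ℝ := real_inner_self_pos.2 hb0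
  have hr' : r * ⟪c, c⟫_ℝ = -⟪b, b⟫_ℝ := by
    have h2 : T c b b = (-r) • c := by
      rw [h.L_skew hct hbD hbQ, LinearMap.neg_apply, hr, neg_smul]
    have h3 : ⟪T c b b, c⟫_ℝ = ⟪b, b⟫_ℝ := by rw [h.adj, h.symm, hbD]
    rw [h2, real_inner_smul_left] at h3
    linarith
  have hr0 : 0 < -r := by
    by_contra! H
    nlinarith
  have hs : (√(-r))⁻¹ * (√(-r))⁻¹ * r = -1 := by
    rw [← mul_inv, Real.mul_self_sqrt hr0.le, inv_neg, neg_mul,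
      inv_mul_cancel₀ (by linarith : r < 0).ne]
  refine ⟨(√(-r))⁻¹ • b, ?_, ?_, ?_⟩
  · rw [map_smul, hbD]
  · rw [map_smul, LinearMap.smul_apply, hbQ, smul_neg]
  · simp only [map_smul, LinearMap.smul_apply, hr, smul_smul]
    rw [← mul_assoc, hs, neg_one_smul]

theorem IsEuclidean.quad_skew (h : IsEuclidean T) (hb : IsSkewUnit T c b)
    {b' : V} (h1' : T c c b' = b') (h2' : T c b' c = -b') {r : ℝ} (hr : T b c b' = (-r) • c) :
    T b b' b = (2 * r) • b - b' := by
  have h1 := h.mid b' c b c b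
  rw [h2', h.symm b' c b, hr, hb.norm] at h1
  simp only [map_neg, map_smul, LinearMap.neg_apply, LinearMap.smul_apply, hb.one, h.symm b c c,
    h.symm b' c c, h1'] at h1
  linear_combination (norm := module) -h1

/-- For a primitive tripotent `c` of `V` and a skew unit `b`, the element `d = (c + i b) / 2` of the
complexification spans the `1`-eigenspace of `x ↦ {d, x, d}`. -/
theorem IsEuclidean.eq_smul_half (h : IsEuclidean T) (hc : IsPrimitive T c)
    (hb : IsSkewUnit T c b) {z : ℂ ⊗[ℝ] V}
    (hz : hermitification T (cx ((1 / 2 : ℝ) • c) ((1 / 2 : ℝ) • b)) z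
      (cx ((1 / 2 : ℝ) • c) ((1 / 2 : ℝ) • b)) = z) :
    ∃ t : ℝ, z = (t : ℂ) • cx ((1 / 2 : ℝ) • c) ((1 / 2 : ℝ) • b) := by
  have hct := hc.tripotent
  have hct' : T c c c = c := hct
  obtain ⟨x, y, rfl⟩ := exists_cx z
  rw [hermitification_cx, cx_inj] at hz
  simp only [map_smul, LinearMap.smul_apply, h.symm b _ c] at hz
  obtain ⟨ex, ey⟩ := hz
  have ex' : x = (1 / 4 : ℝ) • (T c x c - T b x b + (2 : ℝ) • T c y b) := by
    linear_combination (norm := module) -ex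
  have ey' : y = (1 / 4 : ℝ) • ((2 : ℝ) • T c x b - T c y c + T b y b) := by
    linear_combination (norm := module) -ey
  have hx : T c c x = x := by
    rw [ex']
    simp only [map_smul, map_add, map_sub, h.tri_one hct hct' hct', h.tri_one hct hb.one hb.one,
      h.tri_one hct hct' hb.one]
  have hy : T c c y = y := by
    rw [ey']
    simp only [map_smul, map_add, map_sub, h.tri_one hct hct' hct', h.tri_one hct hb.one hb.one,
      h.tri_one hct hct' hb.one]
  -- V_1(c) is the sum of ℝc and the skew elements; r measures the skew part b' against b through
  -- {b,c,b'} = -r c.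
  have dec : ∀ x, T c c x = x → ∃ (a : ℝ) (b' : V) (r : ℝ), x = a • c + b' ∧ T c c b' = b' ∧
      T c b' c = -b' ∧ T b c b' = (-r) • c := by
    intro x hx
    have hQ := h.QQ_one hct hx
    obtain ⟨a, ha⟩ := h.eq_smul_of_primitive hc (x := (1 / 2 : ℝ) • (x + T c x c)) (by
      simp only [map_smul, map_add, LinearMap.smul_apply, LinearMap.add_apply, hQ]
      rw [add_comm])
    have h1 : T c c ((1 / 2 : ℝ) • (x - T c x c)) = (1 / 2 : ℝ) • (x - T c x c) := by
      rw [map_smul, map_sub, hx, h.DQ hct]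
    have h2 : T c ((1 / 2 : ℝ) • (x - T c x c)) c = -((1 / 2 : ℝ) • (x - T c x c)) := by
      simp only [map_smul, map_sub, LinearMap.smul_apply, LinearMap.sub_apply, hQ]
      module
    obtain ⟨r, hr⟩ := h.eq_smul_of_primitive hc (h.quad_skew_skew hct hb.one hb.skew h1 h2)
    exact ⟨a, _, -r, by rw [← ha]; module, h1, h2, by rw [hr, neg_neg]⟩
  obtain ⟨α, b₁, r₁, rfl, p1, p2, p3⟩ := dec x hx
  obtain ⟨β, b₂, r₂, rfl, q1, q2, q3⟩ := dec y hy
  have p4 := h.quad_skew hb p1 p2 p3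
  have q4 := h.quad_skew hb q1 q2 q3
  have p5 : T c b₁ b = r₁ • c := by
    rw [h.L_skew hct p1 p2, LinearMap.neg_apply, h.symm, p3]; module
  have q5 : T c b₂ b = r₂ • c := by
    rw [h.L_skew hct q1 q2, LinearMap.neg_apply, h.symm, q3]; module
  simp only [map_add, map_smul, LinearMap.add_apply, LinearMap.smul_apply, hct', p2, q2, p4, q4, p5,
    q5, hb.norm, hb.one] at ex' ey'
  have split : ∀ (s : ℝ) (v : V), T c v c = -v → s • c + v = 0 → s = 0 ∧ v = 0 := by
    intro s v hv hsv
    have h1 := congrArg (fun w => T c w c) hsv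
    simp only [map_add, map_smul, LinearMap.add_apply, LinearMap.smul_apply, hct', hv, map_zero,
      LinearMap.zero_apply] at h1
    have h2 : s • c = 0 := by linear_combination (norm := module) (1 / 2 : ℝ) • (h1 + hsv)
    refine ⟨(smul_eq_zero.1 h2).resolve_right hc.ne_zero, ?_⟩
    rwa [h2, zero_add] at hsv
  -- Separating multiples of c from skew parts yields linear equations, whose only solutions are x =
  -- αc and y = αb.
  obtain ⟨u1, u2⟩ := split (α - (1 / 2) * (α + r₂)) (b₁ - ((1 / 2) * (β - r₁)) • b) (by
    simp only [map_sub, map_smul, LinearMap.sub_apply, LinearMap.smul_apply, p2, hb.skew]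
    module) (by linear_combination (norm := module) ex')
  obtain ⟨v1, v2⟩ := split (β - (1 / 2) * (r₁ - β)) (b₂ - ((1 / 2) * (α + r₂)) • b) (by
    simp only [map_sub, map_smul, LinearMap.sub_apply, LinearMap.smul_apply, q2, hb.skew]
    module) (by linear_combination (norm := module) ey')
  have w1 : (r₁ - (1 / 2) * (β - r₁)) • c = 0 := by
    have := p3
    rw [sub_eq_zero.1 u2, map_smul, hb.norm] at this
    linear_combination (norm := module) this
  have w2 := (smul_eq_zero.1 w1).resolve_right hc.ne_zero
  have hβ : β = 0 := by linarith
  have hr₁ : r₁ = 0 := by linarith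
  have hr₂ : r₂ = α := by linarith
  refine ⟨2 * α, ?_⟩
  rw [real_smul_cx, cx_inj, sub_eq_zero.1 u2, sub_eq_zero.1 v2, hβ, hr₁, hr₂]
  constructor <;> module

theorem IsEuclidean.half_tripotent (h : IsEuclidean T) (hc : IsTripotent T c)
    (hb : IsSkewUnit T c b) :
    IsTripotent (hermitification T) (cx ((1 / 2 : ℝ) • c) ((1 / 2 : ℝ) • b)) ∧
    hermitification T (cx ((1 / 2 : ℝ) • c) ((1 / 2 : ℝ) • b))
      (cx ((1 / 2 : ℝ) • c) ((1 / 2 : ℝ) • b)) (cx ((1 / 2 : ℝ) • c) ((1 / 2 : ℝ) • (-b))) = 0 := by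
  have f0 : T c c c = c := hc
  have f1 : T c b = -T b c := h.L_skew hc hb.one hb.skew
  have f2 : T b b c = c := by rw [h.symm, f1, LinearMap.neg_apply, hb.norm, neg_neg]
  have f3 : T b b b = b := by
    rw [h.quad_skew hb hb.one hb.skew (r := 1) (by rw [hb.norm]; module)]; module
  have f4 : T b c c = b := by rw [h.symm, hb.one]
  unfold IsTripotent
  rw [hermitification_cx, hermitification_cx, cx_inj, cx_eq_zero]
  simp only [map_smul, LinearMap.smul_apply, map_neg, LinearMap.neg_apply, f0, f1, f2, f3, f4,
    hb.one, hb.norm]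
  refine ⟨⟨?_, ?_⟩, ?_, ?_⟩ <;> module

/-- A tripotent f ≤ d satisfies {d,f,d} = f, hence f = t d with t real. Both t and 1 - t are equal
to their cubes, and t ≠ 0, so t = 1. -/
theorem IsEuclidean.half_primitive (h : IsEuclidean T) (hH : IsPHJTS (hermitification T))
    (hc : IsPrimitive T c) (hb : IsSkewUnit T c b) :
    IsPrimitive (hermitification T) (cx ((1 / 2 : ℝ) • c) ((1 / 2 : ℝ) • b)) := by
  have hne : cx ((1 / 2 : ℝ) • c) ((1 / 2 : ℝ) • b) ≠ 0 := fun H => by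
    have := (smul_eq_zero.1 (cx_eq_zero.1 H).1).resolve_left (by norm_num)
    exact hc.ne_zero this
  have ht := (h.half_tripotent hc.tripotent hb).1
  refine ⟨ht, hne, ?_⟩
  rintro f hf hf0 ⟨f', hf', hff', hd⟩
  have h1 : hermitification T f f' = 0 := hff'
  have h2 := hH.L_swap h1
  have h3 : hermitification T (f + f') f (f + f') = f := by
    have h4 : hermitification T f f f' = 0 := by rw [hH.symm, h2]; rfl
    simp [h2, h4, show hermitification T f f f = f from hf]
  rw [← hd] at h3
  obtain ⟨t, htf⟩ := h.eq_smul_half hc hb h3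
  set d := cx ((1 / 2 : ℝ) • c) ((1 / 2 : ℝ) • b)
  have cube : ∀ s : ℝ, IsTripotent (hermitification T) ((s : ℂ) • d) → s * s * s = s := by
    intro s hs
    have h5 : ((s * s * s - s : ℝ) : ℂ) • d = 0 := by
      simp only [IsTripotent, map_smul, LinearMap.map_smulₛₗ, LinearMap.smul_apply,
        Complex.conj_ofReal, show hermitification T d d d = d from ht] at hs
      push_cast
      linear_combination (norm := module) hs
    have := (smul_eq_zero.1 h5).resolve_right hne
    exact sub_eq_zero.1 (by exact_mod_cast this)
  have c1 := cube t (htf ▸ hf)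
  have hf'd : f' = ((1 - t : ℝ) : ℂ) • d := by
    push_cast
    rw [sub_smul, one_smul, ← htf]
    exact eq_sub_of_add_eq' hd.symm
  have c2 := cube (1 - t) (hf'd ▸ hf')
  have ht0 : t ≠ 0 := by
    rintro rfl
    exact hf0 (by rw [htf]; simp)
  have ht1 : t = 1 := by
    have h6 : t * t = 1 := mul_right_cancel₀ ht0 (by rw [c1, one_mul])
    nlinarith
  rw [htf, ht1]
  simp

end Primitive

end Halves

/-! ### The frame of halves and the rank -/

section Main

variable {V : Type*} [NormedAddCommGroup V] [InnerProductSpace ℝ V] [FiniteDimensional ℝ V]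
  {T : V →ₗ[ℝ] V →ₗ[ℝ] V →ₗ[ℝ] V}

/-- The halves of the members of a Jordan frame form a Jordan frame of the Hermitification. -/
theorem IsEuclidean.frame_hermitification (h : IsEuclidean T) (hH : IsPHJTS (hermitification T))
    {ι : Type*} {c b : ι → V} (hc : IsJordanFrame T c) (hb : ∀ i, IsSkewUnit T (c i) (b i)) :
    IsJordanFrame (hermitification T)
      (Sum.elim (fun i => cx ((1 / 2 : ℝ) • c i) ((1 / 2 : ℝ) • b i))
        fun i => conj V (cx ((1 / 2 : ℝ) • c i) ((1 / 2 : ℝ) • b i))) := by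
  have hconj : (fun i => conj V (cx ((1 / 2 : ℝ) • c i) ((1 / 2 : ℝ) • b i))) =
      fun i => cx ((1 / 2 : ℝ) • c i) ((1 / 2 : ℝ) • (-b i)) := by
    ext i; rw [conj_cx, smul_neg]
  rw [hconj]
  have hct := fun i => (hc.primitive i).tripotent
  -- V_1(c_j) lies in V_0(c_i), so L vanishes between V_1(c_i) and V_1(c_j).
  have hL : ∀ {i j}, i ≠ j → ∀ {u v}, T (c i) (c i) u = u → T (c j) (c j) v = v → T u v = 0 := by
    intro i j hij u v hu hv
    refine h.L_one_zero (hct i) hu ?_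
    rw [h.symm, h.L_one_zero (hct j) hv
      ((h.orthogonal_iff (hct j)).1 (hc.orthogonal j i hij.symm))]
    rfl
  have hne : ∀ {i j}, i ≠ j → ∀ {u v}, T (c i) (c i) u = u → T (c j) (c j) v = v →
      IsOrthogonal (hermitification T) (cx ((1 / 2 : ℝ) • c i) ((1 / 2 : ℝ) • u))
        (cx ((1 / 2 : ℝ) • c j) ((1 / 2 : ℝ) • v)) := by
    intro i j hij u v hu hv
    rw [IsOrthogonal]
    ext z
    obtain ⟨z, z', hz⟩ := exists_cx ((1 : ℂ) ⊗ₜ[ℝ] z)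
    have hci : T (c i) (c i) (c i) = c i := hct i
    have hcj : T (c j) (c j) (c j) = c j := hct j
    simp only [TensorProduct.AlgebraTensorModule.curry_apply,
      TensorProduct.curry_apply, hz]
    change hermitification T _ _ (cx z z') = 0
    rw [hermitification_cx]
    simp [hL hij hci hcj, hL hij hci hv, hL hij hu hcj, hL hij hu hv, cx_zero]
  refine ⟨?_, ?_, fun e he H => ?_⟩
  · rintro (i | i)
    · exact h.half_primitive hH (hc.primitive i) (hb i)
    · exact h.half_primitive hH (hc.primitive i) (hb i).neg
  · rintro (i | i) (j | j) hij <;> simp only [Sum.elim_inl, Sum.elim_inr]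
    · exact hne (fun H => hij (by rw [H])) (hb i).one (hb j).one
    · by_cases H : i = j
      · subst H
        have := h.half_tripotent (hct i) (hb i)
        exact hH.orthogonal_of_apply this.1 this.2
      · exact hne H (hb i).one (hb j).neg.one
    · by_cases H : i = j
      · subst H
        have := h.half_tripotent (hct i) (hb i).neg
        rw [neg_neg] at this
        exact hH.orthogonal_of_apply this.1 this.2
      · exact hne H (hb i).neg.one (hb j).one
    · exact hne (fun H => hij (by rw [H])) (hb i).neg.one (hb j).neg.one
  · obtain ⟨x, y, rfl⟩ := exists_cx e
    have h1 : ∀ i, T (c i) (c i) x = 0 ∧ T (c i) (c i) y = 0 := by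
      intro i
      have e1 : hermitification T _ (cx x y) = 0 := H (Sum.inl i)
      have e2 : hermitification T _ (cx x y) = 0 := H (Sum.inr i)
      simp only [Sum.elim_inl, Sum.elim_inr] at e1 e2
      -- Adding the two relations replaces d_i and its conjugate by c_i, so D(c_i) kills the real
      -- and imaginary parts of e.
      have e3 : hermitification T (cx (c i) 0) (cx x y) = 0 := by
        have : cx (c i) 0 = cx ((1 / 2 : ℝ) • c i) ((1 / 2 : ℝ) • b i) +
            cx ((1 / 2 : ℝ) • c i) ((1 / 2 : ℝ) • (-b i)) := by
          rw [cx_add, cx_inj]; constructor <;> module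
        rw [this, map_add, LinearMap.add_apply, e1, e2, add_zero]
      have e4 : hermitification T (cx (c i) 0) (cx (c i) 0) (cx x y) = 0 := by
        rw [hH.symm, hH.L_swap e3]; rfl
      rw [hermitification_cx, cx_eq_zero] at e4
      simpa using e4
    have hx : x ∈ peirceZero T c := mem_peirceZero.2 fun i => (h1 i).1
    have hy : y ∈ peirceZero T c := mem_peirceZero.2 fun i => (h1 i).2
    rw [h.peirceZero_frame hc, Submodule.mem_bot] at hx hy
    exact he.ne_zero (by rw [hx, hy, cx_zero])

theorem IsEuclidean.rank_hermitification (h : IsEuclidean T) (hH : IsPHJTS (hermitification T))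
    (hs : IsSimple T) (hr : ¬ IsReduced T) :
    ∃ r : ℕ, HasRank T r ∧ HasRank (hermitification T) (2 * r) ∧
      ∀ c : Fin r → V, IsJordanFrame T c → ∃ d : Fin r → ℂ ⊗[ℝ] V,
        (∀ j, (1 : ℂ) ⊗ₜ[ℝ] c j = d j + conj V (d j)) ∧
        IsJordanFrame (hermitification T) (Sum.elim d fun j => conj V (d j)) := by
  have key : ∀ {r : ℕ} (c : Fin r → V), IsJordanFrame T c → ∃ d : Fin r → ℂ ⊗[ℝ] V,
      (∀ j, (1 : ℂ) ⊗ₜ[ℝ] c j = d j + conj V (d j)) ∧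
      IsJordanFrame (hermitification T) (Sum.elim d fun j => conj V (d j)) := by
    intro r c hc
    have hex := fun i => h.exists_skewUnit (hc.primitive i) (h.not_isThin hs hr (hc.primitive i))
    choose b hb using hex
    refine ⟨_, fun j => ?_, h.frame_hermitification hH hc hb⟩
    rw [conj_cx, cx_add]
    have : (1 : ℂ) ⊗ₜ[ℝ] c j = cx (c j) 0 := by simp [cx]
    rw [this, cx_inj]
    constructor <;> module
  obtain ⟨r, c, hc⟩ := h.exists_frame
  obtain ⟨d, -, hd⟩ := key c hc
  refine ⟨r, by simpa using hc.hasRank h, ?_, key⟩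
  have := hH.hasRank hd
  rwa [Fintype.card_sum, Fintype.card_fin, ← two_mul] at this

end Main

end JordanTriple

theorem mainTheorem11 {V : Type*} [AddCommGroup V] [Module ℝ V] [FiniteDimensional ℝ V]
    (T : V →ₗ[ℝ] V →ₗ[ℝ] V →ₗ[ℝ] V) (hT : JordanTriple.IsPJTS T)
    (hsimple : JordanTriple.IsSimple T) (hnr : JordanTriple.IsNonReduced T) :
    JordanTriple.IsPHJTS (JordanTriple.hermitification T) ∧
    JordanTriple.IsSimple (JordanTriple.hermitification T) ∧
    ∃ r : ℕ, JordanTriple.HasRank T r ∧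
      JordanTriple.HasRank (JordanTriple.hermitification T) (2 * r) ∧
      ∀ c : Fin r → V, JordanTriple.IsJordanFrame T c →
        ∃ d : Fin r → TensorProduct ℝ ℂ V,
          (∀ j, TensorProduct.tmul ℝ (1 : ℂ) (c j) = d j + JordanTriple.conj V (d j)) ∧
          JordanTriple.IsJordanFrame (JordanTriple.hermitification T)
            (Sum.elim d (fun j => JordanTriple.conj V (d j))) := by
  have hH := JordanTriple.isPHJTS_hermitification hT
  refine ⟨hH, JordanTriple.isSimple_hermitification hsimple hnr.1, ?_⟩
  let := hT.hasForm.core.toNormedAddCommGroup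
  let := InnerProductSpace.ofCore hT.hasForm.core.toCore
  have hE : JordanTriple.IsEuclidean T :=
    { toIsJTS := hT.toIsJTS, adj := hT.hasForm.adj, pos := hT.hasForm.pos }
  exact hE.rank_hermitification hH hsimple hnr.2
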